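/- \textbf{Conventions.} Manifolds are Hausdorff, paracompact, without boundary, of dimension $n$ and of class $C^2$; a pseudo-Riemannian metric is a field of symmetric nondegenerate bilinear forms of constant index $\nu$. $\mathbf L$ is any class of maps between Euclidean spaces with $\mathbf L\subseteq C^1$; a metric is of class $\mathbf L$ if its components in the charts of the given atlas are. Let $g$ be a $C^1$ pseudo-Riemannian metric on $M$. An \emph{envelopment} $\phi:M\to\widehat M$ is a topological embedding into a manifold of the same dimension which is a $C^2$ diffeomorphism onto its (open) image; $\partial_\phi$ is the topological boundary of $\phi(M)$ in $\widehat M$. An \emph{$\mathbf L$-extension of $g$ about} $p\in\partial_\phi$ is an open neighbourhood $U_p$ of $p$ with a metric $\hat g_p$ of index $\nu$ on $\widehat M_p=\phi(M)\cup U_p$, of class $\mathbf L$ on $U_p$, with $\phi^*\hat g_p=g$. We write $\phi\in\mathcal E[\mathbf L]$ if $g$ has an $\mathbf L$-extension about every $p\in\partial_\phi$. \textbf{Bundle metrics.} $LM$ is the bundle of linear frames. For a $C^1$ metric with Levi-Civita connection form $\omega$ and canonical form $\theta$ on $LM$, the bundle metric $d$ is the distance on $LM$ of the Riemannian metric $|X|^2=|\theta(X)|^2+|\omega(X)|^2$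 (the infimum of the lengths of piecewise $C^1$ curves, $\infty$ if there are none). Let $d$ be that of $(M,g)$ on $LM$, and $\hat d_p$ that of $(\widehat M_p,\hat g_p)$ on $L\widehat M_p$. \textbf{Lipschitz boundary.} For a chart $p_\alpha:W_\alpha\to\mathbb R^n$ of $\widehat M$ put $U_\alpha=p_\alpha(W_\alpha\cap\phi(M))$, and let $U_\alpha^*$ be the set of the points $x\in p_\alpha(\partial_\phi\cap W_\alpha)$ such that $g$ has an $\mathbf L$-extension about $p_\alpha^{-1}(x)$ and no neighbourhood of $x$ is contained in $\overline{U_\alpha}$. Then $\phi$ has a \emph{Lipschitz boundary} if $\widehat M$ has a $C^2$-compatible atlas of charts $(W_\alpha,p_\alpha)$ such that: (A) each $\overline{U_\alpha}$ is compact; (B) for each $\alpha$ there is a $C^2$ map $k_\alpha:\mathbb R^n\to\mathbb R^n$ such that for every $x\in U_\alpha^*$ one has $|k_\alpha(x)|=1$ and there are $\delta>0$ and a Lipschitz $f_x:\mathbb R^n\to\mathbb R$ such that, whenever $|y-x|<\delta$, $y\in U_\alpha$ if and only if $k_\alpha(x)\cdot(y-x)<f_x\big((y-x)-(k_\alpha(x)\cdot(y-x))\,k_\alpha(x)\big)$;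 (C) for all $\alpha,\beta$, $|D(p_\alpha\circ p_\beta^{-1})|$ is bounded on $p_\beta(W_\alpha\cap W_\beta\cap\phi(M))$. \textbf{Theorem.} Let $\phi\in\mathcal E[\mathbf L]$ have a Lipschitz boundary, where $\mathbf L\subseteq C^1$ and $g$ is $C^1$. Let $p\in\partial_\phi$ be a point which is not in the interior of $\overline{\phi(M)}$ (that is, $p$ lies in the Lipschitz part $p_\alpha^{-1}(U_\alpha^*)$ of the boundary), and let $(U_p,\hat g_p)$ be an $\mathbf L$-extension of $g$ about $p$. Then $p$ has a neighbourhood $U$ in $\widehat M$ such that, for every compact set $K$ of frames of $\widehat M$, there are no sequences $\tilde x_i,\tilde y_i$ in $LM$, lying over points of $\phi^{-1}(U)$ and with $\phi_*\tilde x_i\in K$ for all $i$, for which $\hat d_p(\phi_*\tilde x_i,\phi_*\tilde y_i)\to0$ while $d(\tilde x_i,\tilde y_i)$ is bounded away from zero. -/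

import Mathlib

open Set Filter Topology
open scoped Manifold ContDiff InnerProductSpace ENNReal

noncomputable section

/-- The coordinate space `ℝⁿ` with its Euclidean norm. -/
abbrev Euc (n : ℕ) : Type := EuclideanSpace ℝ (Fin n)

/-- A class of maps between (subsets of) Euclidean spaces: `L ι κ s f` says that the map
`f : ℝ^ι → ℝ^κ` is of the class on the set `s`. -/
def MapClass : Type 1 :=
  ∀ (ι κ : Type) [Fintype ι] [Fintype κ],
    Set (EuclideanSpace ℝ ι) → (EuclideanSpace ℝ ι → EuclideanSpace ℝ κ) → Prop

/-- The class of `C¹` maps. -/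
def MapClass.C1 : MapClass := fun _ _ _ _ s f => ContDiffOn ℝ 1 f s

/-- `L ⊆ C¹`: every map of the class on an open set is `C¹` there. -/
def MapClass.SubsetC1 (L : MapClass) : Prop :=
  ∀ (ι κ : Type) [Fintype ι] [Fintype κ] (s : Set (EuclideanSpace ℝ ι))
    (f : EuclideanSpace ℝ ι → EuclideanSpace ℝ κ),
    IsOpen s → L ι κ s f → MapClass.C1 ι κ s f

section Manifolds

variable {n : ℕ}
variable {M : Type*} [TopologicalSpace M] [ChartedSpace (Euc n) M]
variable {N : Type*} [TopologicalSpace N] [ChartedSpace (Euc n) N]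

/-! ### Pseudo-Riemannian metrics in charts -/

variable (n M) in
/-- Fields of bilinear forms on the tangent spaces of `M` (covariant 2-tensor fields), without
any regularity. -/
abbrev BilinField : Type _ :=
  ∀ y : M, TangentSpace (𝓡 n) y →L[ℝ] TangentSpace (𝓡 n) y →L[ℝ] ℝ

/-- `G` is, at each point of `s`, a scalar product of index `ν`: symmetric, nondegenerate, and
`ν` is the largest dimension of a subspace on which it is negative definite. -/
def IsMetricOn (ν : ℕ) (G : BilinField n M) (s : Set M) : Prop :=
  ∀ y ∈ s,
    (∀ v w, G y v w = G y w v) ∧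
    (∀ v, (∀ w, G y v w = 0) → v = 0) ∧
    IsGreatest {d : ℕ | ∃ W : Submodule ℝ (TangentSpace (𝓡 n) y),
      Module.finrank ℝ W = d ∧ ∀ w ∈ W, w ≠ 0 → G y w w < 0} ν

/-- The coordinate vector field `∂ᵢ` of the chart `e`, at the point with coordinates `x`. -/
def coordVec (e : OpenPartialHomeomorph M (Euc n)) (x : Euc n) (i : Fin n) :
    TangentSpace (𝓡 n) (e.symm x) :=
  mfderiv (𝓡 n) (𝓡 n) e.symm x (EuclideanSpace.single i (1 : ℝ) : Euc n)

/-- The components `Gᵢⱼ = G(∂ᵢ, ∂ⱼ)` in the chart `e`, as a map from `ℝⁿ` to `ℝ^(n × n)`. -/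
def coordMetric (e : OpenPartialHomeomorph M (Euc n)) (G : BilinField n M) (x : Euc n) :
    EuclideanSpace ℝ (Fin n × Fin n) :=
  WithLp.toLp 2 fun ij => G (e.symm x) (coordVec e x ij.1) (coordVec e x ij.2)

/-- `G` is of class `L` on the open set `s`: its components in each chart of the atlas are. -/
def IsOfClassOn (L : MapClass) (G : BilinField n M) (s : Set M) : Prop :=
  ∀ e ∈ atlas (Euc n) M,
    L (Fin n) (Fin n × Fin n) (e.target ∩ e.symm ⁻¹' s) (coordMetric e G)

/-- The Christoffel symbol `Γᵏᵢⱼ = ½ ∑ₗ Gᵏˡ (∂ᵢ Gⱼₗ + ∂ⱼ Gᵢₗ - ∂ₗ Gᵢⱼ)` of the Levi-Civita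
connection of `G` in the chart `e`, at the point with coordinates `x`. -/
def christoffel (e : OpenPartialHomeomorph M (Euc n)) (G : BilinField n M) (x : Euc n)
    (k i j : Fin n) : ℝ :=
  let h : Matrix (Fin n) (Fin n) ℝ := Matrix.of fun a b => coordMetric e G x (a, b)
  let dh : Fin n → Fin n → Fin n → ℝ := fun a b c =>
    fderiv ℝ (coordMetric e G) x (EuclideanSpace.single a (1 : ℝ)) (b, c)
  2⁻¹ * ∑ l, h⁻¹ k l * (dh i j l + dh j i l - dh l i j)

/-- The coordinate vector `Γ(v, w)`, with components `∑ᵢⱼ Γᵏᵢⱼ vⁱ wʲ`. -/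
def christoffelApply (e : OpenPartialHomeomorph M (Euc n)) (G : BilinField n M) (x : Euc n)
    (v w : Euc n) : Euc n :=
  WithLp.toLp 2 fun k => ∑ i, ∑ j, christoffel e G x k i j * v i * w j

/-! ### The bundle of linear frames and the bundle metric -/

variable (n M) in
/-- The bundle `LM` of linear frames: a point together with a basis of its tangent space. -/
structure FrameBundle where
  base : M
  frame : Module.Basis (Fin n) ℝ (TangentSpace (𝓡 n) base)

/-- The usual topology of `LM`: that of a subset of `M × (TM)ⁿ`. -/
instance FrameBundle.instTopologicalSpace [IsManifold (𝓡 n) 1 M] :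
    TopologicalSpace (FrameBundle n M) :=
  TopologicalSpace.induced
    (fun X => (X.base, fun a => (⟨X.base, X.frame a⟩ : TangentBundle (𝓡 n) M)))
    (inferInstance : TopologicalSpace (M × (Fin n → TangentBundle (𝓡 n) M)))

/-- The chart of `LM` induced by the chart `e` of `M`: coordinates of the base point, and
coordinate components of the frame vectors. -/
def frameCoord (e : OpenPartialHomeomorph M (Euc n)) (X : FrameBundle n M) :
    Euc n × (Fin n → Euc n) :=
  (e X.base, fun a => (mfderiv (𝓡 n) (𝓡 n) e X.base (X.frame a) : Euc n))

/-- `c`, restricted to `[0,1]`, is a `C¹` curve in `LM`. -/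
def IsC1FrameCurve (c : ℝ → FrameBundle n M) : Prop :=
  ContinuousOn (fun t => (c t).base) (Icc 0 1) ∧
  ∀ e ∈ atlas (Euc n) M,
    ContDiffOn ℝ 1 (fun t => frameCoord e (c t)) (Icc 0 1 ∩ {t | (c t).base ∈ e.source})

/-- The components, in the frame `X`, of the tangent vector at `X.base` whose coordinate
components in the chart `e` are `v`. -/
def frameComponents (e : OpenPartialHomeomorph M (Euc n)) (X : FrameBundle n M) (v : Euc n) :
    Fin n → ℝ :=
  X.frame.repr ((mfderiv (𝓡 n) (𝓡 n) e X.base).inverse v)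

/-- The norm of the velocity at time `t` of a curve `c = (γ, E)` in `LM`, for the Riemannian metric
`|X|² = |θ(X)|² + |ω(X)|²`. Here `θ` is the canonical form, so `θ(ċ)` lists the
components of `γ̇` in the frame `E`, and `ω` is the form of the Levi-Civita connection of `G`, so
column `b` of the matrix `ω(ċ)` lists the components of `∇_γ̇ E_b` in the frame `E`. -/
def frameSpeed (G : BilinField n M) (c : ℝ → FrameBundle n M) (t : ℝ) : ℝ :=
  let X := c t
  let e := chartAt (Euc n) X.base
  let u : Euc n × (Fin n → Euc n) := derivWithin (fun s => frameCoord e (c s)) (Icc 0 1) t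
  let θ : Fin n → ℝ := frameComponents e X u.1
  let om : Fin n → Fin n → ℝ := fun a b =>
    frameComponents e X
      (u.2 b + christoffelApply e G (e X.base) u.1 ((frameCoord e X).2 b)) a
  Real.sqrt ((∑ a, θ a ^ 2) + ∑ a, ∑ b, om a b ^ 2)

/-- The infimum of the lengths of the `C¹` curves from `X` to `Y` in the part of `LM` over `Ω`. -/
def c1EDist (G : BilinField n M) (Ω : Set M) (X Y : FrameBundle n M) : ℝ≥0∞ :=
  ⨅ (c : ℝ → FrameBundle n M) (_ : IsC1FrameCurve c) (_ : ∀ t ∈ Icc (0 : ℝ) 1, (c t).base ∈ Ω)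
    (_ : c 0 = X) (_ : c 1 = Y),
    ∫⁻ t in Icc (0 : ℝ) 1, ENNReal.ofReal (frameSpeed G c t)

/-- The bundle metric of `(Ω, G)`: the distance on the frame bundle over the open set `Ω` induced
by the Riemannian metric above, i.e. the infimum of the lengths of the curves from `X` to `Y`
composed of finitely many `C¹` pieces (and `∞` if there is no such curve). -/
def bundleEDist (G : BilinField n M) (Ω : Set M) (X Y : FrameBundle n M) : ℝ≥0∞ :=
  ⨅ (m : ℕ) (Z : ℕ → FrameBundle n M) (_ : Z 0 = X) (_ : Z m = Y),
    ∑ i ∈ Finset.range m, c1EDist G Ω (Z i) (Z (i + 1))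

/-! ### Envelopments and extensions -/

/-- An envelopment: a topological embedding between manifolds of the same dimension which is a
`C²` diffeomorphism onto its (open) image. -/
structure IsEnvelopment (φ : M → N) : Prop where
  isEmbedding : IsEmbedding φ
  isLocalDiffeomorph : IsLocalDiffeomorph (𝓡 n) (𝓡 n) 2 φ

/-- The map `φ_* : LM → LN` of frame bundles. -/
def IsEnvelopment.mapFrame [IsManifold (𝓡 n) 2 M] [IsManifold (𝓡 n) 2 N] {φ : M → N}
    (hφ : IsEnvelopment (n := n) φ) (X : FrameBundle n M) : FrameBundle n N where
  base := φ X.base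
  frame := X.frame.map
    (hφ.isLocalDiffeomorph.mfderivToContinuousLinearEquiv two_ne_zero X.base).toLinearEquiv

/-- `(U, G)` is an extension of class `L` of the metric `g` about `p`: `U` is an open neighbourhood
of `p`, and `G` is a metric of index `ν` on `φ(M) ∪ U`, of class `L` on `U`, with `φ^* G = g`. -/
structure IsExtensionAbout (L : MapClass) (ν : ℕ) (φ : M → N) (g : BilinField n M) (p : N)
    (U : Set N) (G : BilinField n N) : Prop where
  isOpen : IsOpen U
  mem : p ∈ U
  isMetricOn : IsMetricOn ν G (range φ ∪ U)
  isOfClassOn : IsOfClassOn L G U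
  pullback : ∀ (x : M) (v w : TangentSpace (𝓡 n) x),
    G (φ x) (mfderiv (𝓡 n) (𝓡 n) φ x v) (mfderiv (𝓡 n) (𝓡 n) φ x w) = g x v w

/-- `g` is `L`-extendible about `p`. -/
def IsExtendibleAbout (L : MapClass) (ν : ℕ) (φ : M → N) (g : BilinField n M) (p : N) : Prop :=
  ∃ (U : Set N) (G : BilinField n N), IsExtensionAbout L ν φ g p U G

/-! ### Lipschitz boundaries -/

/-- The set `U_α`: the part of the image of the chart `e` which corresponds to `φ(M)`. -/
def chartRegion (φ : M → N) (e : OpenPartialHomeomorph N (Euc n)) : Set (Euc n) :=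
  e '' (e.source ∩ range φ)

/-- The set `U_α^*` of the images in the chart `e` of the boundary points about which `g` is
`L`-extendible, except those which have a neighbourhood contained in the closure of `U_α`. -/
def chartBoundary (L : MapClass) (ν : ℕ) (φ : M → N) (g : BilinField n M)
    (e : OpenPartialHomeomorph N (Euc n)) : Set (Euc n) :=
  {x | ∃ q ∈ e.source ∩ frontier (range φ), e q = x ∧ IsExtendibleAbout L ν φ g q} \
    {x | x ∈ frontier (chartRegion φ e) ∧ closure (chartRegion φ e) ∈ 𝓝 x}

/-- The envelopment `φ` has a Lipschitz boundary, with respect to some atlas of `N` (compatible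
with its `C²` structure). -/
def HasLipschitzBoundary (L : MapClass) (ν : ℕ) (φ : M → N) (g : BilinField n M) : Prop :=
  ∃ A : Set (OpenPartialHomeomorph N (Euc n)),
    A ⊆ IsManifold.maximalAtlas (𝓡 n) 2 N ∧
    (∀ y : N, ∃ e ∈ A, y ∈ e.source) ∧
    (∀ e ∈ A,
      IsCompact (closure (chartRegion φ e)) ∧
      ∃ k : Euc n → Euc n, ContDiff ℝ 2 k ∧
        ∀ x ∈ chartBoundary L ν φ g e, ‖k x‖ = 1 ∧
          ∃ δ > 0, ∃ f : Euc n → ℝ, (∃ C, LipschitzWith C f) ∧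
            ∀ y, ‖y - x‖ < δ →
              (y ∈ chartRegion φ e ↔
                ⟪k x, y - x⟫_ℝ < f ((y - x) - ⟪k x, y - x⟫_ℝ • k x))) ∧
    (∀ e ∈ A, ∀ e' ∈ A, ∃ C : ℝ, ∀ z ∈ e' '' (e'.source ∩ e.source ∩ range φ),
      ‖fderiv ℝ (e ∘ e'.symm) z‖ ≤ C)

end Manifolds

end

/-! Near a Lipschitz boundary point a domain has no thin slits: two nearby points of it can be
joined inside it by a path whose length is at most a fixed multiple of their Euclidean distance. A
curve for `d` has to stay in `φ(M)`, while one for the extended metric may cross the boundary. The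
theorem says that this freedom gains at most a constant factor on small distances starting from a
compact set of frames. The resulting inequality is `bundleEDist g ≤ Λ * bundleEDist gp`, and it
excludes the sequences at once.

The comparison passes through the coordinates `(x, F)` of a frame in one chart about `p`. The
components of the extended metric are `C¹` across the boundary, so its Christoffel symbols are
continuous there. Over a compact set of frames the bundle norm therefore lies between two positive
multiples of the Euclidean norm (`exists_coordSpeed_bounds`). Since `frameSpeed` is computed in a
preferred chart that changes along the curve, its independence of the chart comes first; this rests
on the transformation law `christoffelVec_comp`.

Lower bound (`mul_edist_frameCoord_le_bundleEDist`): a short curve for the extended metric cannot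
leave a coordinate ball about its starting frame, so its length controls the coordinate distance,
wherever it runs with respect to `φ(M)`. Only the starting frame has to lie in the compact set.

Upper bound (`IsEnvelopment.bundleEDist_le_of_lipschitz_graph`): two frames over the region below
the graph are joined by three segments: down along `-k`, across, and up again. A descent
proportional to the horizontal displacement suffices by the Lipschitz condition
(`sub_smul_mem_of_lipschitz_graph`). On this path `g` has the components of the extended metric, so
the same speed bound applies. -/

set_option maxSynthPendingDepth 3

noncomputable section

/-! ### Christoffel symbols of a field of matrices on `ℝⁿ` -/

/-- The bilinear form on `ℝⁿ` with given components. -/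
def bilinOfComponents (n : ℕ) :
    EuclideanSpace ℝ (Fin n × Fin n) →L[ℝ] Euc n →L[ℝ] Euc n →L[ℝ] ℝ :=
  ∑ ab : Fin n × Fin n, (EuclideanSpace.proj ab : EuclideanSpace ℝ (Fin n × Fin n) →L[ℝ] ℝ).smulRight
    ((EuclideanSpace.proj ab.1 : Euc n →L[ℝ] ℝ).smulRight (EuclideanSpace.proj ab.2 : Euc n →L[ℝ] ℝ))

theorem bilinOfComponents_apply {n : ℕ} (m : EuclideanSpace ℝ (Fin n × Fin n)) (v w : Euc n) :
    bilinOfComponents n m v w = ∑ a, ∑ b, m (a, b) * v a * w b := by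
  simp only [bilinOfComponents, sum_apply, ContinuousLinearMap.smulRight_apply,
    smul_apply, PiLp.proj_apply, smul_eq_mul, Fintype.sum_prod_type,
    mul_assoc]

theorem bilinOfComponents_single {n : ℕ} (m : EuclideanSpace ℝ (Fin n × Fin n)) (a b : Fin n) :
    bilinOfComponents n m (EuclideanSpace.single a 1) (EuclideanSpace.single b 1) = m (a, b) := by
  simp [bilinOfComponents_apply]

/-- The square matrix with given components. -/
def matrixOfComponents {n : ℕ} (m : EuclideanSpace ℝ (Fin n × Fin n)) : Matrix (Fin n) (Fin n) ℝ :=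
  Matrix.of fun a b => m (a, b)

/-- `m` lists the components of a symmetric nondegenerate bilinear form. -/
structure IsScalarProduct {n : ℕ} (m : EuclideanSpace ℝ (Fin n × Fin n)) : Prop where
  symm : ∀ v w, bilinOfComponents n m v w = bilinOfComponents n m w v
  nondeg : ∀ v, (∀ w, bilinOfComponents n m v w = 0) → v = 0

namespace IsScalarProduct

variable {n : ℕ} {m : EuclideanSpace ℝ (Fin n × Fin n)}

theorem det_ne_zero (hm : IsScalarProduct m) : (matrixOfComponents m).det ≠ 0 := by
  intro h0
  obtain ⟨v, hv, h⟩ := Matrix.exists_mulVec_eq_zero_iff.mpr h0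
  refine hv ?_
  have : WithLp.toLp 2 v = (0 : Euc n) := by
    refine hm.nondeg _ fun w => ?_
    rw [hm.symm, bilinOfComponents_apply]
    have h' : ∀ a, ∑ b, m (a, b) * v b = 0 := fun a => congrFun h a
    calc ∑ a, ∑ b, m (a, b) * w a * v b = ∑ a, w a * ∑ b, m (a, b) * v b := by
          simp only [Finset.mul_sum]
          exact Finset.sum_congr rfl fun a _ => Finset.sum_congr rfl fun b _ => by ring
      _ = 0 := by simp [h']
  funext i
  exact congrArg (fun u : Euc n => u i) this

theorem ext_left (hm : IsScalarProduct m) {v v' : Euc n}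
    (h : ∀ w, bilinOfComponents n m v w = bilinOfComponents n m v' w) : v = v' := by
  refine sub_eq_zero.mp (hm.nondeg _ fun w => ?_)
  rw [map_sub, sub_apply, h w, sub_self]

end IsScalarProduct

/-- The vector `Γ(v, w)` of the Christoffel symbols of the matrix field `h`. -/
def christoffelVec {n : ℕ} (h : Euc n → EuclideanSpace ℝ (Fin n × Fin n)) (x v w : Euc n) : Euc n :=
  WithLp.toLp 2 fun k => ∑ i, ∑ j,
    (2⁻¹ * ∑ l, (matrixOfComponents (h x))⁻¹ k l *
      (fderiv ℝ h x (EuclideanSpace.single i (1 : ℝ)) (j, l) +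
        fderiv ℝ h x (EuclideanSpace.single j (1 : ℝ)) (i, l) -
        fderiv ℝ h x (EuclideanSpace.single l (1 : ℝ)) (i, j))) * v i * w j

theorem linearMap_apply_eq_sum {n : ℕ} {F : Type*} [NormedAddCommGroup F] [NormedSpace ℝ F]
    (A : Euc n →L[ℝ] F) (v : Euc n) :
    A v = ∑ i, v i • A (EuclideanSpace.single i (1 : ℝ)) := by
  conv_lhs => rw [← (EuclideanSpace.basisFun (Fin n) ℝ).sum_repr v]
  simp [map_sum]

theorem bilinOfComponents_fderiv_apply {n : ℕ} (A : Euc n →L[ℝ] EuclideanSpace ℝ (Fin n × Fin n))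
    (u v w : Euc n) :
    bilinOfComponents n (A u) v w =
      ∑ i, ∑ a, ∑ b, A (EuclideanSpace.single i (1 : ℝ)) (a, b) * u i * v a * w b := by
  rw [linearMap_apply_eq_sum A u, map_sum, sum_apply,
    sum_apply]
  refine Finset.sum_congr rfl fun i _ => ?_
  rw [map_smul, smul_apply, smul_apply,
    bilinOfComponents_apply, smul_eq_mul, Finset.mul_sum]
  refine Finset.sum_congr rfl fun a _ => ?_
  rw [Finset.mul_sum]
  exact Finset.sum_congr rfl fun b _ => by ring

/-- The Koszul formula for coordinate vector fields. -/
theorem two_mul_bilin_christoffelVec {n : ℕ} {h : Euc n → EuclideanSpace ℝ (Fin n × Fin n)}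
    {x : Euc n} (hx : IsScalarProduct (h x)) (v w z : Euc n) :
    2 * bilinOfComponents n (h x) (christoffelVec h x v w) z =
      bilinOfComponents n (fderiv ℝ h x v) w z + bilinOfComponents n (fderiv ℝ h x w) v z -
        bilinOfComponents n (fderiv ℝ h x z) v w := by
  set D : Fin n → Fin n → Fin n → ℝ := fun i a b =>
    fderiv ℝ h x (EuclideanSpace.single i (1 : ℝ)) (a, b) with hD
  -- The Christoffel vector with its index lowered; `christoffelVec` is the inverse matrix applied
  -- to `q`.
  set q : Fin n → ℝ := fun l => 2⁻¹ * ∑ i, ∑ j, (D i j l + D j i l - D l i j) * v i * w j with hq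
  have hΓ : ∀ k, christoffelVec h x v w k = ((matrixOfComponents (h x))⁻¹.mulVec q) k := by
    intro k
    have e1 : christoffelVec h x v w k = ∑ i, ∑ j,
        (2⁻¹ * ∑ l, (matrixOfComponents (h x))⁻¹ k l * (D i j l + D j i l - D l i j)) * v i * w j :=
      rfl
    rw [e1]
    simp only [Matrix.mulVec, dotProduct, hq, Finset.mul_sum, Finset.sum_mul]
    rw [Finset.sum_comm' (s := Finset.univ) (t := fun _ => Finset.univ) (t' := Finset.univ)
      (s' := fun _ => Finset.univ) (by simp)]
    conv_rhs => rw [Finset.sum_comm]; enter [2, i]; rw [Finset.sum_comm]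
    rw [Finset.sum_comm]
    refine Finset.sum_congr rfl fun i _ => Finset.sum_congr rfl fun j _ =>
      Finset.sum_congr rfl fun l _ => by ring
  have hmul : (matrixOfComponents (h x)).mulVec (fun k => christoffelVec h x v w k) = q := by
    rw [show (fun k => christoffelVec h x v w k) = _ from funext hΓ, Matrix.mulVec_mulVec,
      Matrix.mul_nonsing_inv _ (isUnit_iff_ne_zero.mpr hx.det_ne_zero), Matrix.one_mulVec]
  have hB : bilinOfComponents n (h x) (christoffelVec h x v w) z = ∑ a, z a * q a := by
    rw [hx.symm, bilinOfComponents_apply]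
    refine Finset.sum_congr rfl fun a _ => ?_
    rw [← hmul]
    simp only [Matrix.mulVec, dotProduct, Finset.mul_sum]
    exact Finset.sum_congr rfl fun b _ => by simp only [matrixOfComponents, Matrix.of_apply]; ring
  rw [hB, bilinOfComponents_fderiv_apply, bilinOfComponents_fderiv_apply,
    bilinOfComponents_fderiv_apply]
  have r1 : ∑ i, ∑ a, ∑ b, D i a b * v i * w a * z b = ∑ l, ∑ i, ∑ j, D i j l * v i * w j * z l := by
    rw [Finset.sum_comm' (s := Finset.univ) (t := fun _ => Finset.univ) (t' := Finset.univ)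
      (s' := fun _ => Finset.univ) (by simp)]
    conv_rhs => rw [Finset.sum_comm]; enter [2, i]; rw [Finset.sum_comm]
    rw [Finset.sum_comm]
  have r2 : ∑ i, ∑ a, ∑ b, D i a b * w i * v a * z b = ∑ l, ∑ i, ∑ j, D j i l * v i * w j * z l := by
    conv_rhs => rw [Finset.sum_comm]; enter [2, i]; rw [Finset.sum_comm]
    rw [Finset.sum_comm]
    exact Finset.sum_congr rfl fun i _ => Finset.sum_congr rfl fun j _ =>
      Finset.sum_congr rfl fun l _ => by ring
  have r3 : ∑ i, ∑ a, ∑ b, D i a b * z i * v a * w b = ∑ l, ∑ i, ∑ j, D l i j * v i * w j * z l :=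
    Finset.sum_congr rfl fun i _ => Finset.sum_congr rfl fun j _ =>
      Finset.sum_congr rfl fun l _ => by ring
  change _ = ∑ i, ∑ a, ∑ b, D i a b * v i * w a * z b + ∑ i, ∑ a, ∑ b, D i a b * w i * v a * z b -
    ∑ i, ∑ a, ∑ b, D i a b * z i * v a * w b
  rw [r1, r2, r3, ← Finset.sum_add_distrib, ← Finset.sum_sub_distrib, Finset.mul_sum]
  refine Finset.sum_congr rfl fun l _ => ?_
  simp only [hq, ← Finset.sum_add_distrib, ← Finset.sum_sub_distrib, Finset.mul_sum]
  refine Finset.sum_congr rfl fun i _ => ?_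
  exact Finset.sum_congr rfl fun j _ => by ring

/-- The transformation law of the Christoffel symbols under a `C²` change of coordinates `ψ`. -/
theorem christoffelVec_comp {n : ℕ} {h h' : Euc n → EuclideanSpace ℝ (Fin n × Fin n)}
    {ψ : Euc n → Euc n} {x : Euc n} (hψ : ContDiffAt ℝ 2 ψ x)
    (hsurj : Function.Surjective (fderiv ℝ ψ x))
    (hd : DifferentiableAt ℝ h x) (hd' : DifferentiableAt ℝ h' (ψ x))
    (hm : IsScalarProduct (h x)) (hm' : IsScalarProduct (h' (ψ x)))
    (heq : ∀ᶠ y in 𝓝 x, ∀ v w, bilinOfComponents n (h y) v w =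
      bilinOfComponents n (h' (ψ y)) (fderiv ℝ ψ y v) (fderiv ℝ ψ y w)) (v w : Euc n) :
    christoffelVec h' (ψ x) (fderiv ℝ ψ x v) (fderiv ℝ ψ x w) + fderiv ℝ (fderiv ℝ ψ) x v w =
      fderiv ℝ ψ x (christoffelVec h x v w) := by
  set B := bilinOfComponents n
  set A := fderiv ℝ ψ x with hA
  set T := fderiv ℝ (fderiv ℝ ψ) x with hT
  have hψd : HasFDerivAt ψ A x := (hψ.differentiableAt two_ne_zero).hasFDerivAt
  have hAd : HasFDerivAt (fderiv ℝ ψ) T x :=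
    ((hψ.fderiv_right (m := 1) (by norm_num)).differentiableAt one_ne_zero).hasFDerivAt
  have hsymm : ∀ a b, T a b = T b a := fun a b =>
    (hψ.isSymmSndFDerivAt (by simp)).eq a b
  -- The product rule applied to the pullback identity `heq`: besides the derivative of `h'` there
  -- are two terms in the second derivative `T` of `ψ`.
  have hder : ∀ u a b, B (fderiv ℝ h x u) a b = B (fderiv ℝ h' (ψ x) (A u)) (A a) (A b) +
      B (h' (ψ x)) (T u a) (A b) + B (h' (ψ x)) (A a) (T u b) := by
    intro u a b
    have l0 : HasFDerivAt (fun y => B (h y)) _ x := B.hasFDerivAt.comp x hd.hasFDerivAt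
    have l0' : HasFDerivAt (fun y => B (h' (ψ y))) _ x :=
      B.hasFDerivAt.comp x (hd'.hasFDerivAt.comp x hψd)
    have l1 : HasFDerivAt (fun y => B (h y) a b) _ x :=
      (l0.clm_apply (hasFDerivAt_const a x)).clm_apply
        (hasFDerivAt_const b x)
    have l2 : HasFDerivAt (fun y => B (h' (ψ y)) (fderiv ℝ ψ y a) (fderiv ℝ ψ y b)) _ x :=
      (l0'.clm_apply
        (hAd.clm_apply (hasFDerivAt_const a x))).clm_apply
        (hAd.clm_apply (hasFDerivAt_const b x))
    have l3 := l2.congr_of_eventuallyEq (f₁ := fun y => B (h y) a b)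
      (heq.mono fun y hy => hy a b)
    have := congrArg (fun L : Euc n →L[ℝ] ℝ => L u) (l1.unique l3)
    simp at this
    rw [this]
    ring
  refine hm'.ext_left fun z' => ?_
  obtain ⟨z, rfl⟩ := hsurj z'
  have k1 : 2 * B (h x) (christoffelVec h x v w) z = B (fderiv ℝ h x v) w z +
      B (fderiv ℝ h x w) v z - B (fderiv ℝ h x z) v w := two_mul_bilin_christoffelVec hm v w z
  have k2 : 2 * B (h' (ψ x)) (christoffelVec h' (ψ x) (A v) (A w)) (A z) =
      B (fderiv ℝ h' (ψ x) (A v)) (A w) (A z) + B (fderiv ℝ h' (ψ x) (A w)) (A v) (A z) -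
        B (fderiv ℝ h' (ψ x) (A z)) (A v) (A w) :=
    two_mul_bilin_christoffelVec hm' (A v) (A w) (A z)
  have k3 : B (h x) (christoffelVec h x v w) z =
      B (h' (ψ x)) (A (christoffelVec h x v w)) (A z) :=
    heq.self_of_nhds (christoffelVec h x v w) z
  have s1 : B (h' (ψ x)) (A w) (T v z) = B (h' (ψ x)) (T v z) (A w) := hm'.symm _ _
  have s2 : B (h' (ψ x)) (A v) (T w z) = B (h' (ψ x)) (T w z) (A v) := hm'.symm _ _
  -- In the Koszul combination the terms in `T v z` and `T w z` cancel by the symmetry of `T` and of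
  -- the form; `T v w` survives twice, which is the inhomogeneous term of the law.
  rw [hder, hder, hder, hsymm z v, hsymm z w, hsymm w v] at k1
  rw [map_add, add_apply]
  linarith

/-! ### The bundle metric in coordinates -/

/-- The matrix whose columns are the vectors of `F`. -/
def frameMatrix {n : ℕ} (F : Fin n → Euc n) : Matrix (Fin n) (Fin n) ℝ := Matrix.of fun i a => F a i

/-- The components of `v` in the frame `F` of `ℝⁿ`. -/
def frameCoef {n : ℕ} (F : Fin n → Euc n) (v : Euc n) : Fin n → ℝ :=
  (frameMatrix F)⁻¹.mulVec v

theorem frameMatrix_mulVec {n : ℕ} (F : Fin n → Euc n) (θ : Fin n → ℝ) (i : Fin n) :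
    (frameMatrix F).mulVec θ i = (∑ a, θ a • F a) i := by
  simp [frameMatrix, Matrix.mulVec, dotProduct, mul_comm]

theorem frameCoef_eq {n : ℕ} {F : Fin n → Euc n} (hF : (frameMatrix F).det ≠ 0) {v : Euc n}
    {θ : Fin n → ℝ} (h : ∑ a, θ a • F a = v) : frameCoef F v = θ := by
  have : (frameMatrix F).mulVec θ = v := by
    funext i
    rw [frameMatrix_mulVec, h]
  rw [frameCoef, ← this, Matrix.mulVec_mulVec, Matrix.nonsing_inv_mul _
    (isUnit_iff_ne_zero.mpr hF), Matrix.one_mulVec]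

theorem eq_zero_of_frameCoef_eq_zero {n : ℕ} {F : Fin n → Euc n} (hF : (frameMatrix F).det ≠ 0)
    {v : Euc n} (h : ∀ a, frameCoef F v a = 0) : v = 0 := by
  have h1 : (frameMatrix F).mulVec (frameCoef F v) = v := by
    rw [frameCoef, Matrix.mulVec_mulVec, Matrix.mul_nonsing_inv _
      (isUnit_iff_ne_zero.mpr hF), Matrix.one_mulVec]
  rw [show frameCoef F v = 0 from funext h, Matrix.mulVec_zero] at h1
  ext i
  exact (congrFun h1 i).symm

theorem frameMatrix_det_ne_zero_iff {n : ℕ} {F : Fin n → Euc n} :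
    (frameMatrix F).det ≠ 0 ↔ LinearIndependent ℝ F := by
  rw [Ne, ← Matrix.exists_mulVec_eq_zero_iff, Fintype.linearIndependent_iff]
  constructor
  · intro h θ hθ i
    by_contra hi
    refine h ⟨θ, fun h0 => hi (congrFun h0 i), ?_⟩
    funext j
    rw [frameMatrix_mulVec, hθ]
    rfl
  · rintro h ⟨θ, hθ, h0⟩
    refine hθ (funext fun i => h θ ?_ i)
    ext j
    rw [← frameMatrix_mulVec, h0]
    rfl

/-- The norm of the bundle metric in coordinates: `z` is a point of the frame bundle, `u` a tangent
vector at `z`, and `h` lists the components of the metric. -/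
def coordSpeed {n : ℕ} (h : Euc n → EuclideanSpace ℝ (Fin n × Fin n))
    (z u : Euc n × (Fin n → Euc n)) : ℝ :=
  Real.sqrt ((∑ a, frameCoef z.2 u.1 a ^ 2) +
    ∑ a, ∑ b, frameCoef z.2 (u.2 b + christoffelVec h z.1 u.1 (z.2 b)) a ^ 2)

theorem christoffelVec_smul {n : ℕ} (h : Euc n → EuclideanSpace ℝ (Fin n × Fin n)) (x v w : Euc n)
    (r : ℝ) : christoffelVec h x (r • v) w = r • christoffelVec h x v w := by
  ext k
  simp only [christoffelVec, PiLp.smul_apply, smul_eq_mul, Finset.mul_sum]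
  refine Finset.sum_congr rfl fun i _ => Finset.sum_congr rfl fun j _ => ?_
  simp only [Finset.sum_mul, Finset.mul_sum]
  exact Finset.sum_congr rfl fun l _ => by ring

theorem christoffelVec_zero {n : ℕ} (h : Euc n → EuclideanSpace ℝ (Fin n × Fin n)) (x w : Euc n) :
    christoffelVec h x 0 w = 0 := by
  simpa using christoffelVec_smul h x 0 w 0

theorem frameCoef_smul {n : ℕ} (F : Fin n → Euc n) (v : Euc n) (r : ℝ) (a : Fin n) :
    frameCoef F (r • v) a = r * frameCoef F v a := by
  simp only [frameCoef, WithLp.ofLp_smul, Matrix.mulVec_smul, Pi.smul_apply, smul_eq_mul]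

theorem coordSpeed_smul {n : ℕ} (h : Euc n → EuclideanSpace ℝ (Fin n × Fin n))
    (z u : Euc n × (Fin n → Euc n)) (r : ℝ) : coordSpeed h z (r • u) = |r| * coordSpeed h z u := by
  rw [coordSpeed, coordSpeed, ← Real.sqrt_sq_eq_abs, ← Real.sqrt_mul (sq_nonneg r)]
  congr 1
  simp only [Prod.smul_fst, Prod.smul_snd, Pi.smul_apply, christoffelVec_smul, ← smul_add,
    frameCoef_smul, mul_pow, mul_add, Finset.mul_sum]

/-- If `θ` vanishes then so does the base component of `u`. The Christoffel term then disappears,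
and `ω` merely lists the components of `u.2` in the frame. Hence the definiteness needs nothing of
`h`. -/
theorem coordSpeed_pos {n : ℕ} (h : Euc n → EuclideanSpace ℝ (Fin n × Fin n))
    {z u : Euc n × (Fin n → Euc n)} (hz : (frameMatrix z.2).det ≠ 0) (hu : u ≠ 0) :
    0 < coordSpeed h z u := by
  rw [coordSpeed, Real.sqrt_pos]
  have n1 : 0 ≤ ∑ a, frameCoef z.2 u.1 a ^ 2 := Finset.sum_nonneg fun _ _ => sq_nonneg _
  have n2 : 0 ≤ ∑ a, ∑ b, frameCoef z.2 (u.2 b + christoffelVec h z.1 u.1 (z.2 b)) a ^ 2 :=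
    Finset.sum_nonneg fun _ _ => Finset.sum_nonneg fun _ _ => sq_nonneg _
  refine lt_of_le_of_ne (add_nonneg n1 n2) fun h0 => hu ?_
  have z1 : ∑ a, frameCoef z.2 u.1 a ^ 2 = 0 := by linarith
  have z2 : ∑ a, ∑ b, frameCoef z.2 (u.2 b + christoffelVec h z.1 u.1 (z.2 b)) a ^ 2 = 0 := by
    linarith
  have u1 : u.1 = 0 := eq_zero_of_frameCoef_eq_zero hz fun a => by
    simpa using (Finset.sum_eq_zero_iff_of_nonneg fun _ _ => sq_nonneg _).mp z1 a
      (Finset.mem_univ a)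
  have u2 : u.2 = 0 := by
    funext b
    refine eq_zero_of_frameCoef_eq_zero hz fun a => ?_
    have := (Finset.sum_eq_zero_iff_of_nonneg fun _ _ =>
      Finset.sum_nonneg fun _ _ => sq_nonneg _).mp z2 a (Finset.mem_univ a)
    have := (Finset.sum_eq_zero_iff_of_nonneg fun _ _ => sq_nonneg _).mp this b (Finset.mem_univ b)
    simpa [u1, christoffelVec_zero] using this
  exact Prod.ext u1 u2

/-- The points of the frame bundle of `Ω ⊆ ℝⁿ`, in coordinates. -/
def frameDomain {n : ℕ} (Ω : Set (Euc n)) : Set (Euc n × (Fin n → Euc n)) :=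
  {z | z.1 ∈ Ω ∧ (frameMatrix z.2).det ≠ 0}

theorem continuous_frameMatrix {n : ℕ} : Continuous (frameMatrix (n := n)) :=
  continuous_pi fun i => continuous_pi fun a => by
    change Continuous fun F : Fin n → Euc n => F a i
    fun_prop

theorem isOpen_frameDomain {n : ℕ} {Ω : Set (Euc n)} (hΩ : IsOpen Ω) : IsOpen (frameDomain Ω) :=
  (hΩ.preimage continuous_fst).inter
    (isOpen_ne.preimage (continuous_frameMatrix.comp continuous_snd).matrix_det)

theorem ContinuousOn.matrix_inv {X : Type*} [TopologicalSpace X] {n : ℕ} {s : Set X}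
    {A : X → Matrix (Fin n) (Fin n) ℝ} (hA : ContinuousOn A s) (h : ∀ x ∈ s, (A x).det ≠ 0) :
    ContinuousOn (fun x => (A x)⁻¹) s := by
  have hd : ContinuousOn (fun x => (A x).det) s :=
    (continuous_id.matrix_det (A := fun B : Matrix (Fin n) (Fin n) ℝ => B)).comp_continuousOn hA
  have ha : ContinuousOn (fun x => (A x).adjugate) s :=
    (continuous_id.matrix_adjugate (A := fun B : Matrix (Fin n) (Fin n) ℝ => B)).comp_continuousOn hA
  simp only [Matrix.inv_def, Ring.inverse_eq_inv']
  exact (hd.inv₀ h).smul ha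

/-- This is where `C¹` regularity of the metric enters: one derivative of `h` and the inverse matrix
are continuous. -/
theorem continuousOn_christoffelVec {n : ℕ} {h : Euc n → EuclideanSpace ℝ (Fin n × Fin n)}
    {Ω : Set (Euc n)} (hΩ : IsOpen Ω) (hh : ContDiffOn ℝ 1 h Ω)
    (hsp : ∀ x ∈ Ω, IsScalarProduct (h x)) :
    ContinuousOn (fun q : Euc n × Euc n × Euc n => christoffelVec h q.1 q.2.1 q.2.2)
      (Ω ×ˢ univ) := by
  have hinv : ContinuousOn (fun x => (matrixOfComponents (h x))⁻¹) Ω := by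
    refine ContinuousOn.matrix_inv ?_ fun x hx => (hsp x hx).det_ne_zero
    refine continuousOn_pi.mpr fun i => continuousOn_pi.mpr fun j => ?_
    change ContinuousOn (fun x => h x (i, j)) Ω
    exact (PiLp.continuous_apply 2 _ (i, j)).comp_continuousOn hh.continuousOn
  have hinv' : ∀ k l, ContinuousOn
      (fun q : Euc n × Euc n × Euc n => (matrixOfComponents (h q.1))⁻¹ k l) (Ω ×ˢ univ) :=
    fun k l => (continuousOn_pi.mp (continuousOn_pi.mp hinv k) l).comp continuousOn_fst
      fun q hq => hq.1
  have hder : ∀ i a b, ContinuousOn (fun q : Euc n × Euc n × Euc n =>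
      fderiv ℝ h q.1 (EuclideanSpace.single i (1 : ℝ)) (a, b)) (Ω ×ˢ univ) := fun i a b =>
    ((PiLp.continuous_apply 2 _ (a, b)).comp_continuousOn
      ((hh.continuousOn_fderiv_of_isOpen hΩ le_rfl).clm_apply continuousOn_const)).comp
      continuousOn_fst fun q hq => hq.1
  refine (PiLp.continuous_toLp 2 _).comp_continuousOn (continuousOn_pi.mpr fun k => ?_)
  refine continuousOn_finsetSum _ fun i _ => continuousOn_finsetSum _ fun j _ => ?_
  refine ((continuousOn_const.mul (continuousOn_finsetSum _ fun l _ => (hinv' k l).mul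
    (((hder i j l).add (hder j i l)).sub (hder l i j)))).mul ?_).mul ?_
  · exact Continuous.continuousOn (by fun_prop)
  · exact Continuous.continuousOn (by fun_prop)

theorem continuousOn_coordSpeed {n : ℕ} {h : Euc n → EuclideanSpace ℝ (Fin n × Fin n)}
    {Ω : Set (Euc n)} (hΩ : IsOpen Ω) (hh : ContDiffOn ℝ 1 h Ω)
    (hsp : ∀ x ∈ Ω, IsScalarProduct (h x)) :
    ContinuousOn (fun q : (Euc n × (Fin n → Euc n)) × (Euc n × (Fin n → Euc n)) =>
      coordSpeed h q.1 q.2) (frameDomain Ω ×ˢ univ) := by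
  have hinv : ContinuousOn (fun q : (Euc n × (Fin n → Euc n)) × (Euc n × (Fin n → Euc n)) =>
      (frameMatrix q.1.2)⁻¹) (frameDomain Ω ×ˢ univ) :=
    ContinuousOn.matrix_inv (continuous_frameMatrix.comp (by fun_prop)).continuousOn
      fun q hq => hq.1.2
  have hcoef : ∀ {v : (Euc n × (Fin n → Euc n)) × (Euc n × (Fin n → Euc n)) → Euc n},
      ContinuousOn v (frameDomain Ω ×ˢ univ) → ∀ a,
      ContinuousOn (fun q => frameCoef q.1.2 (v q) a) (frameDomain Ω ×ˢ univ) := by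
    intro v hv a
    change ContinuousOn (fun q => ∑ i, (frameMatrix q.1.2)⁻¹ a i * v q i) _
    refine continuousOn_finsetSum _ fun i _ =>
      (continuousOn_pi.mp (continuousOn_pi.mp hinv a) i).mul ?_
    exact (PiLp.continuous_apply 2 _ i).comp_continuousOn hv
  refine Real.continuous_sqrt.comp_continuousOn (ContinuousOn.add ?_ ?_)
  · exact continuousOn_finsetSum _ fun a _ => (hcoef (by fun_prop) a).pow 2
  · refine continuousOn_finsetSum _ fun a _ => continuousOn_finsetSum _ fun b _ =>
      (hcoef ?_ a).pow 2
    refine ContinuousOn.add (by fun_prop) ?_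
    refine (continuousOn_christoffelVec hΩ hh hsp).comp
      (f := fun q : (Euc n × (Fin n → Euc n)) × (Euc n × (Fin n → Euc n)) =>
        (q.1.1, q.2.1, q.1.2 b)) (by fun_prop) fun q hq => ⟨hq.1.1, mem_univ _⟩

/-- By homogeneity in `u` it suffices to bound the speed on `K` times the unit sphere, a compact set
on which it is continuous and positive. -/
theorem exists_coordSpeed_bounds {n : ℕ} {h : Euc n → EuclideanSpace ℝ (Fin n × Fin n)}
    {Ω : Set (Euc n)} (hΩ : IsOpen Ω) (hh : ContDiffOn ℝ 1 h Ω)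
    (hsp : ∀ x ∈ Ω, IsScalarProduct (h x)) {K : Set (Euc n × (Fin n → Euc n))} (hK : IsCompact K)
    (hKΩ : K ⊆ frameDomain Ω) :
    ∃ c > 0, ∃ C > 0, ∀ z ∈ K, ∀ u, c * ‖u‖ ≤ coordSpeed h z u ∧ coordSpeed h z u ≤ C * ‖u‖ := by
  have hcomp : IsCompact (K ×ˢ Metric.sphere (0 : Euc n × (Fin n → Euc n)) 1) :=
    hK.prod (isCompact_sphere _ _)
  have hcont := (continuousOn_coordSpeed hΩ hh hsp).mono
    (prod_mono hKΩ (subset_univ (Metric.sphere (0 : Euc n × (Fin n → Euc n)) 1)))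
  obtain ⟨c, hc, hc'⟩ := hcomp.exists_forall_le' hcont (a := 0) fun q hq =>
    coordSpeed_pos h (hKΩ hq.1).2 (ne_zero_of_mem_unit_sphere (⟨q.2, hq.2⟩ : Metric.sphere _ _))
  obtain ⟨C, hC⟩ := hcomp.exists_bound_of_continuousOn hcont
  -- The maximum only ensures a positive constant; the bound `C` from compactness may fail to be
  -- positive, for instance on an empty set.
  refine ⟨c, hc, max C 1, by positivity, fun z hz u => ?_⟩
  rcases eq_or_ne u 0 with rfl | hu
  · have := coordSpeed_smul h z 0 0
    simp only [smul_zero, abs_zero, zero_mul] at this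
    simp [this]
  have hn : 0 < ‖u‖ := norm_pos_iff.mpr hu
  have hmem : (z, ‖u‖⁻¹ • u) ∈ K ×ˢ Metric.sphere (0 : Euc n × (Fin n → Euc n)) 1 :=
    ⟨hz, by simp [norm_smul, hn.ne']⟩
  have heq : coordSpeed h z u = coordSpeed h z (‖u‖⁻¹ • u) * ‖u‖ := by
    rw [coordSpeed_smul, abs_of_pos (inv_pos.mpr hn)]
    rw [mul_right_comm, inv_mul_cancel₀ hn.ne', one_mul]
  have h1 : c ≤ coordSpeed h z (‖u‖⁻¹ • u) := hc' (z, ‖u‖⁻¹ • u) hmem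
  have h2 : ‖coordSpeed h z (‖u‖⁻¹ • u)‖ ≤ C := hC (z, ‖u‖⁻¹ • u) hmem
  rw [heq]
  exact ⟨mul_le_mul_of_nonneg_right h1 hn.le, mul_le_mul_of_nonneg_right
    (((Real.le_norm_self _).trans h2).trans (le_max_left _ _)) hn.le⟩

/-! ### Changes of charts -/

/-- The map of the frame bundle of `ℝⁿ` induced by the map `ψ`. -/
def frameMap {n : ℕ} (ψ : Euc n → Euc n) (z : Euc n × (Fin n → Euc n)) :
    Euc n × (Fin n → Euc n) :=
  (ψ z.1, fun a => fderiv ℝ ψ z.1 (z.2 a))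

/-- The derivative of `frameMap ψ` at `z` in the direction `u`. -/
def frameMapDeriv {n : ℕ} (ψ : Euc n → Euc n) (z u : Euc n × (Fin n → Euc n)) :
    Euc n × (Fin n → Euc n) :=
  (fderiv ℝ ψ z.1 u.1, fun a => fderiv ℝ (fderiv ℝ ψ) z.1 u.1 (z.2 a) + fderiv ℝ ψ z.1 (u.2 a))

theorem contDiffAt_frameMap {n : ℕ} {ψ : Euc n → Euc n} {z : Euc n × (Fin n → Euc n)}
    (hψ : ContDiffAt ℝ 2 ψ z.1) : ContDiffAt ℝ 1 (frameMap ψ) z := by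
  have h1 : ContDiffAt ℝ 1 (fderiv ℝ ψ) z.1 := hψ.fderiv_right (m := 1) (by norm_num)
  refine ((hψ.of_le (by norm_num)).comp z contDiffAt_fst).prodMk ?_
  refine contDiffAt_pi.mpr fun a => (h1.comp z contDiffAt_fst).clm_apply ?_
  exact contDiffAt_pi.mp contDiffAt_snd a

theorem hasDerivWithinAt_frameMap {n : ℕ} {ψ : Euc n → Euc n}
    {γ : ℝ → Euc n × (Fin n → Euc n)} {u : Euc n × (Fin n → Euc n)} {s : Set ℝ} {t : ℝ}
    (hψ : ContDiffAt ℝ 2 ψ (γ t).1) (hγ : HasDerivWithinAt γ u s t) :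
    HasDerivWithinAt (fun r => frameMap ψ (γ r)) (frameMapDeriv ψ (γ t) u) s t := by
  have h1 : HasFDerivAt (fderiv ℝ ψ) (fderiv ℝ (fderiv ℝ ψ) (γ t).1) (γ t).1 :=
    ((hψ.fderiv_right (m := 1) (by norm_num)).differentiableAt one_ne_zero).hasFDerivAt
  have h0 : HasFDerivAt ψ (fderiv ℝ ψ (γ t).1) (γ t).1 :=
    (hψ.differentiableAt two_ne_zero).hasFDerivAt
  have g1 : HasDerivWithinAt (fun r => (γ r).1) u.1 s t :=
    (hasFDerivAt_fst (𝕜 := ℝ) (p := γ t)).comp_hasDerivWithinAt t hγ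
  have g2 : ∀ a, HasDerivWithinAt (fun r => (γ r).2 a) (u.2 a) s t := fun a =>
    hasDerivWithinAt_pi.mp ((hasFDerivAt_snd (𝕜 := ℝ) (p := γ t)).comp_hasDerivWithinAt t hγ) a
  have k1 : HasDerivWithinAt (fun r => ψ (γ r).1) (fderiv ℝ ψ (γ t).1 u.1) s t :=
    h0.comp_hasDerivWithinAt t g1
  have k2 : HasDerivWithinAt (fun r => fderiv ℝ ψ (γ r).1)
      (fderiv ℝ (fderiv ℝ ψ) (γ t).1 u.1) s t := h1.comp_hasDerivWithinAt t g1
  exact k1.prodMk (hasDerivWithinAt_pi.mpr fun a => k2.clm_apply (g2 a))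

theorem sum_frameCoef_smul {n : ℕ} {F : Fin n → Euc n} (hF : (frameMatrix F).det ≠ 0) (v : Euc n) :
    ∑ a, frameCoef F v a • F a = v := by
  ext i
  rw [← frameMatrix_mulVec, frameCoef, Matrix.mulVec_mulVec, Matrix.mul_nonsing_inv _
    (isUnit_iff_ne_zero.mpr hF), Matrix.one_mulVec]

/-- The bundle metric does not depend on the coordinates. -/
theorem coordSpeed_frameMap {n : ℕ} {h h' : Euc n → EuclideanSpace ℝ (Fin n × Fin n)}
    {ψ : Euc n → Euc n} {z : Euc n × (Fin n → Euc n)} (hψ : ContDiffAt ℝ 2 ψ z.1)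
    (hsurj : Function.Surjective (fderiv ℝ ψ z.1))
    (hd : DifferentiableAt ℝ h z.1) (hd' : DifferentiableAt ℝ h' (ψ z.1))
    (hm : IsScalarProduct (h z.1)) (hm' : IsScalarProduct (h' (ψ z.1)))
    (heq : ∀ᶠ y in 𝓝 z.1, ∀ v w, bilinOfComponents n (h y) v w =
      bilinOfComponents n (h' (ψ y)) (fderiv ℝ ψ y v) (fderiv ℝ ψ y w))
    (hz : (frameMatrix z.2).det ≠ 0) (hz' : (frameMatrix (frameMap ψ z).2).det ≠ 0)
    (u : Euc n × (Fin n → Euc n)) :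
    coordSpeed h' (frameMap ψ z) (frameMapDeriv ψ z u) = coordSpeed h z u := by
  -- Vector and frame are mapped by the same linear map, so the components do not change.
  have hcoef : ∀ v, frameCoef (frameMap ψ z).2 (fderiv ℝ ψ z.1 v) = frameCoef z.2 v := by
    intro v
    refine frameCoef_eq hz' ?_
    conv_rhs => rw [← sum_frameCoef_smul hz v, map_sum]
    simp only [map_smul, frameMap]
  -- The second derivative of `ψ` in `frameMapDeriv` is exactly the inhomogeneous term of the
  -- Christoffel law, so the covariant derivative transforms as a vector.
  have hvec : ∀ b, (frameMapDeriv ψ z u).2 b + christoffelVec h' (frameMap ψ z).1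
      (frameMapDeriv ψ z u).1 ((frameMap ψ z).2 b) =
      fderiv ℝ ψ z.1 (u.2 b + christoffelVec h z.1 u.1 (z.2 b)) := by
    intro b
    rw [map_add, ← christoffelVec_comp hψ hsurj hd hd' hm hm' heq]
    simp only [frameMapDeriv, frameMap]
    abel
  rw [coordSpeed, coordSpeed]
  simp only [hvec, hcoef]
  simp only [frameMapDeriv, hcoef]

theorem coordSpeed_congr {n : ℕ} {h h' : Euc n → EuclideanSpace ℝ (Fin n × Fin n)}
    {z : Euc n × (Fin n → Euc n)} (heq : h =ᶠ[𝓝 z.1] h') (u : Euc n × (Fin n → Euc n)) :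
    coordSpeed h z u = coordSpeed h' z u := by
  have : christoffelVec h z.1 = christoffelVec h' z.1 := by
    funext v w
    simp only [christoffelVec, heq.fderiv_eq, heq.eq_of_nhds]
  simp only [coordSpeed, this]

/-- The points `e.symm (e y)` and `y` are equal only propositionally, so the values of `G` there are
compared after both tangent spaces are read as `Euc n`. -/
theorem BilinField.apply_congr {n : ℕ} {M : Type*} [TopologicalSpace M]
    [ChartedSpace (Euc n) M] {G : BilinField n M} {y y' : M} (h : y = y') (v w : Euc n) :
    (show Euc n →L[ℝ] Euc n →L[ℝ] ℝ from G y) v w =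
      (show Euc n →L[ℝ] Euc n →L[ℝ] ℝ from G y') v w := by
  subst h
  rfl

theorem bilinOfComponents_of_apply {n : ℕ} (B : Euc n →L[ℝ] Euc n →L[ℝ] ℝ) (D : Euc n →L[ℝ] Euc n)
    (v w : Euc n) :
    bilinOfComponents n (WithLp.toLp 2 fun ab : Fin n × Fin n =>
      B (D (EuclideanSpace.single ab.1 1)) (D (EuclideanSpace.single ab.2 1))) v w =
      B (D v) (D w) := by
  rw [bilinOfComponents_apply, linearMap_apply_eq_sum D v, linearMap_apply_eq_sum D w, map_sum B,
    sum_apply]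
  refine Finset.sum_congr rfl fun a _ => ?_
  rw [map_smul, smul_apply, map_sum, Finset.smul_sum]
  refine Finset.sum_congr rfl fun b _ => ?_
  rw [map_smul, smul_eq_mul, smul_eq_mul]
  ring

/-! ### Metrics, frames and speeds in arbitrary charts of the `C²` structure. -/

section Charts

variable {n : ℕ} {M : Type*} [TopologicalSpace M] [ChartedSpace (Euc n) M]
  {e e' : OpenPartialHomeomorph M (Euc n)}

theorem mdifferentiable_of_mem_maximalAtlas (he : e ∈ IsManifold.maximalAtlas (𝓡 n) 2 M) :
    e.MDifferentiable (𝓡 n) (𝓡 n) :=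
  ⟨(contMDiffOn_of_mem_maximalAtlas he).mdifferentiableOn two_ne_zero,
    (contMDiffOn_symm_of_mem_maximalAtlas he).mdifferentiableOn two_ne_zero⟩

theorem contDiffAt_coordChange (he : e ∈ IsManifold.maximalAtlas (𝓡 n) 2 M)
    (he' : e' ∈ IsManifold.maximalAtlas (𝓡 n) 2 M) {x : Euc n} (hx : x ∈ e.target)
    (hx' : e.symm x ∈ e'.source) : ContDiffAt ℝ 2 (e' ∘ e.symm) x :=
  ((contMDiffAt_of_mem_maximalAtlas he' hx').comp x
    (contMDiffAt_symm_of_mem_maximalAtlas he hx)).contDiffAt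

theorem mfderiv_chart_eq (he : e ∈ IsManifold.maximalAtlas (𝓡 n) 2 M)
    (he' : e' ∈ IsManifold.maximalAtlas (𝓡 n) 2 M) {y : M} (hy : y ∈ e.source)
    (hy' : y ∈ e'.source) (v : TangentSpace (𝓡 n) y) :
    (mfderiv (𝓡 n) (𝓡 n) e' y v : Euc n) =
      fderiv ℝ (e' ∘ e.symm) (e y) (mfderiv (𝓡 n) (𝓡 n) e y v : Euc n) := by
  have h1 : e' =ᶠ[𝓝 y] (e' ∘ e.symm) ∘ e := by
    filter_upwards [e.open_source.mem_nhds hy] with z hz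
    simp [e.left_inv hz]
  have hψ : ContDiffAt ℝ 2 (e' ∘ e.symm) (e y) :=
    contDiffAt_coordChange he he' (e.map_source hy) (by rwa [e.left_inv hy])
  have h2 : MDifferentiableAt (𝓡 n) (𝓡 n) (e' ∘ e.symm) (e y) :=
    (hψ.differentiableAt two_ne_zero).mdifferentiableAt
  have h3 := (mdifferentiable_of_mem_maximalAtlas he).mdifferentiableAt hy
  have h4 : mfderiv (𝓡 n) (𝓡 n) e' y =
      (mfderiv (𝓡 n) (𝓡 n) (e' ∘ e.symm) (e y)).comp (mfderiv (𝓡 n) (𝓡 n) e y) := by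
    rw [← mfderiv_comp y h2 h3]
    exact h1.mfderiv_eq
  have h5 := congrArg (fun A => (A v : Euc n)) h4
  refine h5.trans ?_
  rw [mfderiv_eq_fderiv]
  rfl

theorem surjective_fderiv_coordChange (he : e ∈ IsManifold.maximalAtlas (𝓡 n) 2 M)
    (he' : e' ∈ IsManifold.maximalAtlas (𝓡 n) 2 M) {y : M} (hy : y ∈ e.source)
    (hy' : y ∈ e'.source) : Function.Surjective (fderiv ℝ (e' ∘ e.symm) (e y)) := by
  intro w
  obtain ⟨v, hv⟩ := (mdifferentiable_of_mem_maximalAtlas he').mfderiv_surjective hy' w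
  exact ⟨mfderiv (𝓡 n) (𝓡 n) e y v, (mfderiv_chart_eq he he' hy hy' v).symm.trans hv⟩

theorem bilinField_apply_eq (he : e ∈ IsManifold.maximalAtlas (𝓡 n) 2 M) (G : BilinField n M)
    {y : M} (hy : y ∈ e.source) (v w : TangentSpace (𝓡 n) y) :
    G y v w = bilinOfComponents n (coordMetric e G (e y))
      (mfderiv (𝓡 n) (𝓡 n) e y v : Euc n) (mfderiv (𝓡 n) (𝓡 n) e y w : Euc n) := by
  set D : Euc n →L[ℝ] Euc n := mfderiv (𝓡 n) (𝓡 n) e.symm (e y) with hD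
  have h1 : ∀ u : TangentSpace (𝓡 n) y, D (mfderiv (𝓡 n) (𝓡 n) e y u) = u := fun u =>
    congrArg (fun A => (A u : Euc n))
      ((mdifferentiable_of_mem_maximalAtlas he).symm_comp_deriv hy)
  have h2 := bilinOfComponents_of_apply (show Euc n →L[ℝ] Euc n →L[ℝ] ℝ from G (e.symm (e y))) D
    (mfderiv (𝓡 n) (𝓡 n) e y v : Euc n) (mfderiv (𝓡 n) (𝓡 n) e y w : Euc n)
  rw [h1, h1] at h2
  exact ((BilinField.apply_congr (e.left_inv hy) v w).symm).trans h2.symm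

theorem coordMetric_coordChange (he : e ∈ IsManifold.maximalAtlas (𝓡 n) 2 M)
    (he' : e' ∈ IsManifold.maximalAtlas (𝓡 n) 2 M) (G : BilinField n M) {x : Euc n}
    (hx : x ∈ e.target) (hx' : e.symm x ∈ e'.source) (v w : Euc n) :
    bilinOfComponents n (coordMetric e G x) v w =
      bilinOfComponents n (coordMetric e' G ((e' ∘ e.symm) x))
        (fderiv ℝ (e' ∘ e.symm) x v) (fderiv ℝ (e' ∘ e.symm) x w) := by
  obtain ⟨y, hy, rfl⟩ : ∃ y ∈ e.source, e y = x := ⟨e.symm x, e.map_target hx, e.right_inv hx⟩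
  rw [e.left_inv hy] at hx'
  have hs := (mdifferentiable_of_mem_maximalAtlas he).mfderiv_surjective hy
  obtain ⟨v, rfl⟩ := hs v
  obtain ⟨w, rfl⟩ := hs w
  refine (bilinField_apply_eq he G hy v w).symm.trans ((bilinField_apply_eq he' G hx' v w).trans ?_)
  rw [mfderiv_chart_eq he he' hy hx' v, mfderiv_chart_eq he he' hy hx' w]
  simp only [Function.comp_apply, e.left_inv hy]

theorem isScalarProduct_coordMetric (he : e ∈ IsManifold.maximalAtlas (𝓡 n) 2 M) {ν : ℕ}
    {G : BilinField n M} {s : Set M} (hG : IsMetricOn ν G s) {x : Euc n} (hx : x ∈ e.target)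
    (hxs : e.symm x ∈ s) : IsScalarProduct (coordMetric e G x) := by
  obtain ⟨y, hy, rfl⟩ : ∃ y ∈ e.source, e y = x := ⟨e.symm x, e.map_target hx, e.right_inv hx⟩
  rw [e.left_inv hy] at hxs
  have hs := (mdifferentiable_of_mem_maximalAtlas he).mfderiv_surjective hy
  constructor
  · intro v w
    obtain ⟨v, rfl⟩ := hs v
    obtain ⟨w, rfl⟩ := hs w
    exact ((bilinField_apply_eq he G hy v w).symm.trans ((hG y hxs).1 v w)).trans
      (bilinField_apply_eq he G hy w v)
  · intro v hv
    obtain ⟨v, rfl⟩ := hs v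
    have : v = 0 := (hG y hxs).2.1 v fun w => (bilinField_apply_eq he G hy v w).trans (hv _)
    rw [this, map_zero]
    rfl

/-- A metric which is `C¹` in the charts of the atlas is `C¹` in every chart. -/
theorem contDiffOn_coordMetric [IsManifold (𝓡 n) 2 M] (he : e ∈ IsManifold.maximalAtlas (𝓡 n) 2 M)
    {G : BilinField n M} {s : Set M} (hs : IsOpen s) (hG : IsOfClassOn MapClass.C1 G s) :
    ContDiffOn ℝ 1 (coordMetric e G) (e.target ∩ e.symm ⁻¹' s) := by
  intro x hx
  refine ContDiffAt.contDiffWithinAt ?_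
  -- The class is prescribed in the charts of the given atlas only. The components in `e` are those
  -- in `e'` multiplied by first derivatives of a `C²` change of charts, hence again `C¹`.
  set e' := chartAt (Euc n) (e.symm x) with he'
  have hmem : e' ∈ IsManifold.maximalAtlas (𝓡 n) 2 M := IsManifold.chart_mem_maximalAtlas _
  have hx' : e.symm x ∈ e'.source := mem_chart_source _ _
  have hψ := contDiffAt_coordChange he hmem hx.1 hx'
  have hψ1 : ContDiffAt ℝ 1 (fderiv ℝ (e' ∘ e.symm)) x := hψ.fderiv_right (m := 1) (by norm_num)
  have hc : ContDiffAt ℝ 1 (coordMetric e' G) ((e' ∘ e.symm) x) := by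
    have h1 : ContDiffOn ℝ 1 (coordMetric e' G) (e'.target ∩ e'.symm ⁻¹' s) :=
      hG e' (chart_mem_atlas _ _)
    refine h1.contDiffAt ((e'.isOpen_inter_preimage_symm hs).mem_nhds ⟨e'.map_source hx', ?_⟩)
    simpa [e'.left_inv hx'] using hx.2
  have hev : ∀ᶠ z in 𝓝 x, z ∈ e.target ∩ e.symm ⁻¹' e'.source :=
    (e.isOpen_inter_preimage_symm e'.open_source).mem_nhds ⟨hx.1, hx'⟩
  refine (contDiffAt_piLp 2).mpr fun ab => ?_
  have h2 : ContDiffAt ℝ 1 (fun z => bilinOfComponents n (coordMetric e' G ((e' ∘ e.symm) z)))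
      x :=
    (bilinOfComponents n).contDiff.contDiffAt.comp x
      (hc.comp x (hψ.of_le (by norm_num)))
  have h3 := (h2.clm_apply (hψ1.clm_apply (contDiffAt_const
    (c := (EuclideanSpace.single ab.1 1 : Euc n))))).clm_apply (hψ1.clm_apply (contDiffAt_const
    (c := (EuclideanSpace.single ab.2 1 : Euc n))))
  refine h3.congr_of_eventuallyEq (hev.mono fun z hz => ?_)
  exact (bilinOfComponents_single _ _ _).symm.trans
    (coordMetric_coordChange he hmem G hz.1 hz.2 _ _)

theorem frameMatrix_frameCoord_det_ne_zero (he : e ∈ IsManifold.maximalAtlas (𝓡 n) 2 M)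
    (X : FrameBundle n M) (hX : X.base ∈ e.source) :
    (frameMatrix (frameCoord e X).2).det ≠ 0 := by
  rw [frameMatrix_det_ne_zero_iff]
  exact X.frame.linearIndependent.map'
    ((mdifferentiable_of_mem_maximalAtlas he).mfderiv hX).toLinearEquiv.toLinearMap
    (LinearEquiv.ker _)

theorem frameComponents_eq (he : e ∈ IsManifold.maximalAtlas (𝓡 n) 2 M)
    (X : FrameBundle n M) (hX : X.base ∈ e.source) (v : Euc n) :
    frameComponents e X v = frameCoef (frameCoord e X).2 v := by
  set A := (mdifferentiable_of_mem_maximalAtlas he).mfderiv hX with hA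
  have hinv : (mfderiv (𝓡 n) (𝓡 n) e X.base).inverse v = A.symm v := by
    change (A : TangentSpace (𝓡 n) X.base →L[ℝ] TangentSpace (𝓡 n) (e X.base)).inverse v = _
    rw [ContinuousLinearMap.inverse_equiv]
    rfl
  refine (frameCoef_eq (frameMatrix_frameCoord_det_ne_zero he X hX) ?_).symm
  have h1 := X.frame.sum_repr (A.symm v)
  have h2 : A (∑ a, X.frame.repr (A.symm v) a • X.frame a) = v := by
    rw [h1]
    exact A.apply_symm_apply v
  rw [map_sum] at h2
  refine Eq.trans ?_ h2
  refine Finset.sum_congr rfl fun a _ => ?_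
  rw [map_smul, frameComponents, hinv]
  rfl

theorem frameCoord_coordChange (he : e ∈ IsManifold.maximalAtlas (𝓡 n) 2 M)
    (he' : e' ∈ IsManifold.maximalAtlas (𝓡 n) 2 M) (X : FrameBundle n M)
    (hX : X.base ∈ e.source) (hX' : X.base ∈ e'.source) :
    frameCoord e' X = frameMap (e' ∘ e.symm) (frameCoord e X) := by
  refine Prod.ext ?_ (funext fun a => mfderiv_chart_eq he he' hX hX' _)
  simp [frameCoord, frameMap, e.left_inv hX]

theorem frameCoord_eventuallyEq (he : e ∈ IsManifold.maximalAtlas (𝓡 n) 2 M)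
    (he' : e' ∈ IsManifold.maximalAtlas (𝓡 n) 2 M) {c : ℝ → FrameBundle n M} {s : Set ℝ} {t : ℝ}
    (hc : ContinuousWithinAt (fun r => (c r).base) s t) (ht : (c t).base ∈ e.source)
    (ht' : (c t).base ∈ e'.source) :
    (fun r => frameCoord e' (c r)) =ᶠ[𝓝[s] t]
      fun r => frameMap (e' ∘ e.symm) (frameCoord e (c r)) := by
  filter_upwards [hc (e.open_source.mem_nhds ht), hc (e'.open_source.mem_nhds ht')] with r hr hr'
  exact frameCoord_coordChange he he' (c r) hr hr'

theorem contDiffWithinAt_frameCoord (he : e ∈ IsManifold.maximalAtlas (𝓡 n) 2 M)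
    (he' : e' ∈ IsManifold.maximalAtlas (𝓡 n) 2 M) {c : ℝ → FrameBundle n M} {s : Set ℝ} {t : ℝ}
    (hc : ContinuousWithinAt (fun r => (c r).base) s t) (ht : (c t).base ∈ e.source)
    (ht' : (c t).base ∈ e'.source)
    (h : ContDiffWithinAt ℝ 1 (fun r => frameCoord e (c r)) s t) :
    ContDiffWithinAt ℝ 1 (fun r => frameCoord e' (c r)) s t := by
  refine ContDiffWithinAt.congr_of_eventuallyEq ?_ (frameCoord_eventuallyEq he he' hc ht ht')
    (frameCoord_coordChange he he' (c t) ht ht')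
  refine ContDiffAt.comp_contDiffWithinAt t (contDiffAt_frameMap ?_) h
  exact contDiffAt_coordChange he he' (e.map_source ht)
    (by simpa [frameCoord, e.left_inv ht] using ht')

/-- The definition tests atlas charts, on the times spent in their domains. Continuity of the base
curve makes those times a neighbourhood of `t` within `[0,1]`, and the change of charts does the
rest. -/
theorem IsC1FrameCurve.contDiffWithinAt [IsManifold (𝓡 n) 2 M] {c : ℝ → FrameBundle n M} (hc : IsC1FrameCurve c)
    (he : e ∈ IsManifold.maximalAtlas (𝓡 n) 2 M) {t : ℝ} (ht : t ∈ Icc (0 : ℝ) 1)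
    (hte : (c t).base ∈ e.source) :
    ContDiffWithinAt ℝ 1 (fun r => frameCoord e (c r)) (Icc 0 1) t := by
  have hsrc := mem_chart_source (Euc n) (c t).base
  refine contDiffWithinAt_frameCoord (IsManifold.chart_mem_maximalAtlas (c t).base) he
    (hc.1 t ht) hsrc hte ?_
  refine (contDiffWithinAt_inter' ?_).mp (hc.2 _ (chart_mem_atlas _ _) t ⟨ht, hsrc⟩)
  exact hc.1 t ht ((chartAt (Euc n) (c t).base).open_source.mem_nhds hsrc)

theorem isC1FrameCurve_of_contDiffOn [IsManifold (𝓡 n) 2 M] {c : ℝ → FrameBundle n M}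
    (he : e ∈ IsManifold.maximalAtlas (𝓡 n) 2 M)
    (hsrc : ∀ t ∈ Icc (0 : ℝ) 1, (c t).base ∈ e.source)
    (hc : ContDiffOn ℝ 1 (fun r => frameCoord e (c r)) (Icc 0 1)) : IsC1FrameCurve c := by
  have hcont : ContinuousOn (fun t => (c t).base) (Icc 0 1) := by
    have h1 : ContinuousOn (fun t => e.symm (frameCoord e (c t)).1) (Icc 0 1) :=
      e.continuousOn_symm.comp (continuous_fst.comp_continuousOn hc.continuousOn)
        fun t ht => e.map_source (hsrc t ht)
    exact h1.congr fun t ht => (e.left_inv (hsrc t ht)).symm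
  refine ⟨hcont, fun e' he' t ht => ?_⟩
  refine ContDiffWithinAt.mono ?_ inter_subset_left
  exact contDiffWithinAt_frameCoord he (IsManifold.subset_maximalAtlas he') (hcont t ht.1)
    (hsrc t ht.1) ht.2 (hc t ht.1)

/-- The speed of a curve of frames may be computed in any chart. -/
theorem frameSpeed_eq_coordSpeed [IsManifold (𝓡 n) 2 M] (he : e ∈ IsManifold.maximalAtlas (𝓡 n) 2 M) {ν : ℕ}
    {G : BilinField n M} {s : Set M} (hs : IsOpen s) (hG : IsMetricOn ν G s)
    (hG1 : IsOfClassOn MapClass.C1 G s) {c : ℝ → FrameBundle n M} (hc : IsC1FrameCurve c) {t : ℝ}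
    (ht : t ∈ Icc (0 : ℝ) 1) (hte : (c t).base ∈ e.source) (hts : (c t).base ∈ s) :
    frameSpeed G c t = coordSpeed (coordMetric e G) (frameCoord e (c t))
      (derivWithin (fun r => frameCoord e (c r)) (Icc 0 1) t) := by
  set X := c t with hX
  set e0 := chartAt (Euc n) X.base with he0'
  have he0 : e0 ∈ IsManifold.maximalAtlas (𝓡 n) 2 M := IsManifold.chart_mem_maximalAtlas _
  have hsrc : X.base ∈ e0.source := mem_chart_source _ _
  -- By definition the speed is taken in the preferred chart at `c t`; the remainder carries it to
  -- `e`.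
  have h1 : frameSpeed G c t = coordSpeed (coordMetric e0 G) (frameCoord e0 X)
      (derivWithin (fun r => frameCoord e0 (c r)) (Icc 0 1) t) := by
    simp only [frameSpeed, coordSpeed, ← frameComponents_eq he0 X hsrc]
    rfl
  have hψ : ContDiffAt ℝ 2 (e ∘ e0.symm) (e0 X.base) :=
    contDiffAt_coordChange he0 he (e0.map_source hsrc) (by rwa [e0.left_inv hsrc])
  have hu : UniqueDiffWithinAt ℝ (Icc (0 : ℝ) 1) t := uniqueDiffOn_Icc_zero_one t ht
  have hd0 := ((hc.contDiffWithinAt he0 ht hsrc).differentiableWithinAt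
    one_ne_zero).hasDerivWithinAt
  have h2 : derivWithin (fun r => frameCoord e (c r)) (Icc 0 1) t =
      frameMapDeriv (e ∘ e0.symm) (frameCoord e0 X)
        (derivWithin (fun r => frameCoord e0 (c r)) (Icc 0 1) t) := by
    refine HasDerivWithinAt.derivWithin ?_ hu
    exact (hasDerivWithinAt_frameMap hψ hd0).congr_of_eventuallyEq
      (frameCoord_eventuallyEq he0 he (hc.1 t ht) hsrc hte)
      (frameCoord_coordChange he0 he _ hsrc hte)
  have hdiff : ∀ {e₁ : OpenPartialHomeomorph M (Euc n)},
      e₁ ∈ IsManifold.maximalAtlas (𝓡 n) 2 M → X.base ∈ e₁.source →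
      DifferentiableAt ℝ (coordMetric e₁ G) (e₁ X.base) ∧
      IsScalarProduct (coordMetric e₁ G (e₁ X.base)) := fun {e₁} he₁ hX₁ =>
    ⟨((contDiffOn_coordMetric he₁ hs hG1).contDiffAt
      ((e₁.isOpen_inter_preimage_symm hs).mem_nhds ⟨e₁.map_source hX₁,
        by simpa [e₁.left_inv hX₁] using hts⟩)).differentiableAt one_ne_zero,
      isScalarProduct_coordMetric he₁ hG (e₁.map_source hX₁) (by rwa [e₁.left_inv hX₁])⟩
  have hψx : (e ∘ e0.symm) (e0 X.base) = e X.base := by simp [e0.left_inv hsrc]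
  have hev : ∀ᶠ z in 𝓝 (e0 X.base), z ∈ e0.target ∩ e0.symm ⁻¹' e.source :=
    (e0.isOpen_inter_preimage_symm e.open_source).mem_nhds
      ⟨e0.map_source hsrc, by simpa [e0.left_inv hsrc] using hte⟩
  have hcc := frameCoord_coordChange he0 he X hsrc hte
  rw [h1, h2, hcc]
  refine (coordSpeed_frameMap (z := frameCoord e0 X) hψ
    (surjective_fderiv_coordChange he0 he hsrc hte) (hdiff he0 hsrc).1 ?_
    (hdiff he0 hsrc).2 ?_
    (hev.mono fun z hz v w => coordMetric_coordChange he0 he G hz.1 hz.2 v w)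
    (frameMatrix_frameCoord_det_ne_zero he0 X hsrc) ?_ _).symm
  · change DifferentiableAt ℝ (coordMetric e G) ((e ∘ e0.symm) (e0 X.base))
    rw [hψx]
    exact (hdiff he hte).1
  · change IsScalarProduct (coordMetric e G ((e ∘ e0.symm) (e0 X.base)))
    rw [hψx]
    exact (hdiff he hte).2
  · rw [← hcc]
    exact frameMatrix_frameCoord_det_ne_zero he X hte

end Charts

/-! ### Short curves of frames stay in coordinate balls -/

section LowerBound

variable {n : ℕ} {N : Type*} [TopologicalSpace N] [ChartedSpace (Euc n) N] [IsManifold (𝓡 n) 2 N]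
  {e : OpenPartialHomeomorph N (Euc n)} {ν : ℕ} {G : BilinField n N} {s : Set N}
  {z₀ : Euc n × (Fin n → Euc n)} {r c₀ : ℝ}

/-- The displacement is at most the integral of the norm of the derivative, and as long as the curve
is in the ball that norm is at most the bundle speed divided by `c₀`. -/
theorem mul_edist_frameCoord_le_lintegral (he : e ∈ IsManifold.maximalAtlas (𝓡 n) 2 N)
    (hs : IsOpen s) (hG : IsMetricOn ν G s) (hG1 : IsOfClassOn MapClass.C1 G s)
    (hball : Metric.closedBall z₀ r ⊆ frameDomain (e.target ∩ e.symm ⁻¹' s))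
    (hspeed : ∀ z ∈ Metric.closedBall z₀ r, ∀ u, c₀ * ‖u‖ ≤ coordSpeed (coordMetric e G) z u)
    (hc₀ : 0 < c₀) {c : ℝ → FrameBundle n N} (hc : IsC1FrameCurve c) {t : ℝ}
    (ht : t ∈ Icc (0 : ℝ) 1)
    (hP : ∀ τ ∈ Icc 0 t, (c τ).base ∈ e.source ∧ frameCoord e (c τ) ∈ Metric.ball z₀ r) :
    ENNReal.ofReal c₀ * edist (frameCoord e (c t)) (frameCoord e (c 0)) ≤
      ∫⁻ τ in Icc (0 : ℝ) 1, ENNReal.ofReal (frameSpeed G c τ) := by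
  have hsub : Icc 0 t ⊆ Icc (0 : ℝ) 1 := Icc_subset_Icc_right ht.2
  have hdiff : ContDiffOn ℝ 1 (fun τ => frameCoord e (c τ)) (Icc 0 t) := fun τ hτ =>
    (hc.contDiffWithinAt he (hsub hτ) (hP τ hτ).1).mono hsub
  have h1 := enorm_sub_le_lintegral_deriv_of_contDiffOn_Icc hdiff ht.1
  -- Without the endpoints, which have measure zero, `derivWithin` on `[0,1]` is the ordinary
  -- derivative.
  rw [← MeasureTheory.restrict_Ioo_eq_restrict_Icc] at h1
  calc ENNReal.ofReal c₀ * edist (frameCoord e (c t)) (frameCoord e (c 0))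
      ≤ ENNReal.ofReal c₀ * ∫⁻ τ in Ioo 0 t, ‖deriv (fun τ => frameCoord e (c τ)) τ‖ₑ := by
        rw [edist_eq_enorm_sub]
        gcongr
    _ = ∫⁻ τ in Ioo 0 t, ENNReal.ofReal c₀ * ‖deriv (fun τ => frameCoord e (c τ)) τ‖ₑ :=
        (MeasureTheory.lintegral_const_mul' _ _ ENNReal.ofReal_ne_top).symm
    _ ≤ ∫⁻ τ in Ioo 0 t, ENNReal.ofReal (frameSpeed G c τ) := by
        refine MeasureTheory.setLIntegral_mono' measurableSet_Ioo fun τ hτ => ?_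
        have hτ1 : τ ∈ Ioo (0 : ℝ) 1 := ⟨hτ.1, hτ.2.trans_le ht.2⟩
        obtain ⟨hsrc, hb⟩ := hP τ (Ioo_subset_Icc_self hτ)
        have hb' := Metric.ball_subset_closedBall hb
        have hbs : (c τ).base ∈ s := by
          simpa [frameCoord, e.left_inv hsrc] using (hball hb').1.2
        rw [frameSpeed_eq_coordSpeed he hs hG hG1 hc (Ioo_subset_Icc_self hτ1) hsrc hbs,
          derivWithin_of_mem_nhds (Icc_mem_nhds hτ1.1 hτ1.2), ← ofReal_norm,
          ← ENNReal.ofReal_mul hc₀.le]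
        exact ENNReal.ofReal_le_ofReal (hspeed _ hb' _)
    _ ≤ ∫⁻ τ in Icc (0 : ℝ) 1, ENNReal.ofReal (frameSpeed G c τ) :=
        MeasureTheory.lintegral_mono_set (Ioo_subset_Icc_self.trans hsub)

/-- A first-exit argument: up to the first bad time the displacement is at most the length divided
by `c₀`. This closed estimate persists at that time and puts the point strictly inside the ball, a
contradiction. -/
theorem frameCoord_mem_ball_of_lintegral_lt [T2Space N]
    (he : e ∈ IsManifold.maximalAtlas (𝓡 n) 2 N)
    (hs : IsOpen s) (hG : IsMetricOn ν G s) (hG1 : IsOfClassOn MapClass.C1 G s)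
    (hball : Metric.closedBall z₀ r ⊆ frameDomain (e.target ∩ e.symm ⁻¹' s))
    (hspeed : ∀ z ∈ Metric.closedBall z₀ r, ∀ u, c₀ * ‖u‖ ≤ coordSpeed (coordMetric e G) z u)
    (hc₀ : 0 < c₀) {c : ℝ → FrameBundle n N} (hc : IsC1FrameCurve c)
    (hsrc : (c 0).base ∈ e.source)
    (hlen : ENNReal.ofReal c₀ * edist (frameCoord e (c 0)) z₀ +
      ∫⁻ τ in Icc (0 : ℝ) 1, ENNReal.ofReal (frameSpeed G c τ) < ENNReal.ofReal (c₀ * r)) :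
    ∀ τ ∈ Icc (0 : ℝ) 1, (c τ).base ∈ e.source ∧ frameCoord e (c τ) ∈ Metric.ball z₀ r := by
  set ℓ := ∫⁻ τ in Icc (0 : ℝ) 1, ENNReal.ofReal (frameSpeed G c τ) with hℓ
  set P : ℝ → Prop := fun τ => (c τ).base ∈ e.source ∧ frameCoord e (c τ) ∈ Metric.ball z₀ r
    with hPdef
  have hlt : ∀ z, ENNReal.ofReal c₀ * edist z (frameCoord e (c 0)) ≤ ℓ → z ∈ Metric.ball z₀ r := by
    intro z hz
    have h1 : ENNReal.ofReal c₀ * edist z z₀ < ENNReal.ofReal c₀ * ENNReal.ofReal r := by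
      rw [← ENNReal.ofReal_mul hc₀.le]
      refine lt_of_le_of_lt ?_ hlen
      calc ENNReal.ofReal c₀ * edist z z₀
          ≤ ENNReal.ofReal c₀ * (edist z (frameCoord e (c 0)) + edist (frameCoord e (c 0)) z₀) := by
            gcongr
            exact edist_triangle _ _ _
        _ ≤ _ := by
            rw [mul_add, add_comm]
            gcongr
    have h2 := lt_of_mul_lt_mul_left' h1
    rw [edist_dist] at h2
    rw [Metric.mem_ball]
    exact (ENNReal.ofReal_lt_ofReal_iff_of_nonneg dist_nonneg).mp h2
  have hcontc : ∀ τ ∈ Icc (0 : ℝ) 1, (c τ).base ∈ e.source →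
      ContinuousWithinAt (fun τ => frameCoord e (c τ)) (Icc 0 1) τ := fun τ hτ h =>
    (hc.contDiffWithinAt he hτ h).continuousWithinAt
  have hopen : ∀ τ ∈ Icc (0 : ℝ) 1, P τ → ∀ᶠ σ in 𝓝[Icc 0 1] τ, P σ := fun τ hτ hPτ =>
    inter_mem (hc.1 τ hτ (e.open_source.mem_nhds hPτ.1))
      (hcontc τ hτ hPτ.1 (Metric.isOpen_ball.mem_nhds hPτ.2))
  have hP0 : P 0 := ⟨hsrc, hlt _ (by simp)⟩
  by_contra hcon
  set T : Set ℝ := {τ | τ ∈ Icc (0 : ℝ) 1 ∧ ¬ P τ} with hT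
  have hTne : T.Nonempty := by
    by_contra hne
    refine hcon fun τ hτ => ?_
    by_contra hn
    exact hne ⟨τ, hτ, hn⟩
  have hTcl : IsClosed T := by
    rw [← isOpen_compl_iff, isOpen_iff_mem_nhds]
    intro τ hτ
    by_cases hτI : τ ∈ Icc (0 : ℝ) 1
    · have hPτ : P τ := by
        by_contra hn
        exact hτ ⟨hτI, hn⟩
      have := eventually_nhdsWithin_iff.mp (hopen τ hτI hPτ)
      filter_upwards [this] with σ hσ hσT
      exact hσT.2 (hσ hσT.1)
    · filter_upwards [isClosed_Icc.isOpen_compl.mem_nhds hτI] with σ hσ hσT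
      exact hσ hσT.1
  have hTcomp : IsCompact T := isCompact_Icc.of_isClosed_subset hTcl fun τ hτ => hτ.1
  obtain ⟨t, htT, htmin⟩ := hTcomp.exists_isLeast hTne
  have ht01 := htT.1
  have ht0 : 0 < t := lt_of_le_of_ne ht01.1 fun h => htT.2 (h ▸ hP0)
  have hbelow : ∀ τ ∈ Ico 0 t, P τ := by
    intro τ hτ
    by_contra hn
    exact absurd (htmin ⟨⟨hτ.1, hτ.2.le.trans ht01.2⟩, hn⟩) (not_le.mpr hτ.2)
  have hbound : ∀ τ ∈ Ico 0 t,
      ENNReal.ofReal c₀ * edist (frameCoord e (c τ)) (frameCoord e (c 0)) ≤ ℓ := fun τ hτ =>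
    mul_edist_frameCoord_le_lintegral he hs hG hG1 hball hspeed hc₀ hc
      ⟨hτ.1, hτ.2.le.trans ht01.2⟩ fun σ hσ => hbelow σ ⟨hσ.1, hσ.2.trans_lt hτ.2⟩
  have hne : (𝓝[Ico 0 t] t).NeBot := by
    rw [← mem_closure_iff_nhdsWithin_neBot, closure_Ico ht0.ne]
    exact right_mem_Icc.mpr ht0.le
  have hsubI : Ico 0 t ⊆ Icc (0 : ℝ) 1 := fun τ hτ => ⟨hτ.1, hτ.2.le.trans ht01.2⟩
  -- The curve might leave the chart domain at time `t`. Before `t` its base stays in the image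
  -- under `e.symm` of a compact subset of the target, which is closed because `N` is Hausdorff.
  have hbase : (c t).base ∈ e.source := by
    set C : Set N := e.symm '' (Prod.fst '' Metric.closedBall z₀ r) with hC
    have hsubt : Prod.fst '' Metric.closedBall z₀ r ⊆ e.target := by
      rintro _ ⟨z, hz, rfl⟩
      exact (hball hz).1.1
    have hCcomp : IsCompact C :=
      ((isCompact_closedBall _ _).image continuous_fst).image_of_continuousOn
        (e.continuousOn_symm.mono hsubt)
    have hmem : (c t).base ∈ C := by
      refine hCcomp.isClosed.mem_of_tendsto ((hc.1 t ht01).mono hsubI) ?_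
      filter_upwards [self_mem_nhdsWithin] with τ hτ
      exact ⟨(frameCoord e (c τ)).1, ⟨_, Metric.ball_subset_closedBall (hbelow τ hτ).2, rfl⟩,
        e.left_inv (hbelow τ hτ).1⟩
    obtain ⟨x, hx, hx'⟩ := hmem
    rw [← hx']
    exact e.map_target (hsubt hx)
  refine htT.2 ⟨hbase, hlt _ ?_⟩
  have hcl : IsClosed {z | ENNReal.ofReal c₀ * edist z (frameCoord e (c 0)) ≤ ℓ} := by
    refine isClosed_le ?_ continuous_const
    exact (ENNReal.continuous_const_mul ENNReal.ofReal_ne_top).comp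
      (continuous_id.edist continuous_const)
  exact hcl.mem_of_tendsto ((hcontc t ht01 hbase).mono hsubI)
    (by filter_upwards [self_mem_nhdsWithin] with τ hτ using hbound τ hτ)

theorem mul_edist_frameCoord_le_c1EDist [T2Space N]
    (he : e ∈ IsManifold.maximalAtlas (𝓡 n) 2 N)
    (hs : IsOpen s) (hG : IsMetricOn ν G s) (hG1 : IsOfClassOn MapClass.C1 G s)
    (hball : Metric.closedBall z₀ r ⊆ frameDomain (e.target ∩ e.symm ⁻¹' s))
    (hspeed : ∀ z ∈ Metric.closedBall z₀ r, ∀ u, c₀ * ‖u‖ ≤ coordSpeed (coordMetric e G) z u)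
    (hc₀ : 0 < c₀) {Ω : Set N} {X Y : FrameBundle n N} (hX : X.base ∈ e.source)
    (hlen : ENNReal.ofReal c₀ * edist (frameCoord e X) z₀ + c1EDist G Ω X Y <
      ENNReal.ofReal (c₀ * r)) :
    Y.base ∈ e.source ∧
      ENNReal.ofReal c₀ * edist (frameCoord e Y) (frameCoord e X) ≤ c1EDist G Ω X Y := by
  have key : ∀ L, c1EDist G Ω X Y < L → ENNReal.ofReal c₀ * edist (frameCoord e X) z₀ + L <
      ENNReal.ofReal (c₀ * r) → Y.base ∈ e.source ∧
      ENNReal.ofReal c₀ * edist (frameCoord e Y) (frameCoord e X) ≤ L := by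
    intro L hL hLr
    simp only [c1EDist, iInf_lt_iff] at hL
    obtain ⟨c, hc, -, hc0, hc1, hcL⟩ := hL
    subst hc0 hc1
    have hin := frameCoord_mem_ball_of_lintegral_lt he hs hG hG1 hball hspeed hc₀ hc hX
      (lt_of_le_of_lt (by gcongr) hLr)
    exact ⟨(hin 1 (right_mem_Icc.mpr zero_le_one)).1, (mul_edist_frameCoord_le_lintegral he hs hG
      hG1 hball hspeed hc₀ hc (right_mem_Icc.mpr zero_le_one) hin).trans hcL.le⟩
  -- The infimum need not be attained, so the estimate is proved for each larger `L`; replacing `L`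
  -- by `min L b` keeps the smallness condition true.
  obtain ⟨b, hb1, hb2⟩ := exists_between (lt_tsub_iff_left.mpr hlen)
  refine ⟨(key b hb1 (lt_tsub_iff_left.mp hb2)).1, le_of_forall_gt_imp_ge_of_dense fun L hL => ?_⟩
  have := (key (min L b) (lt_min hL hb1) (lt_tsub_iff_left.mp ((min_le_right _ _).trans_lt hb2))).2
  exact this.trans (min_le_left _ _)

/-- Frames at a small distance from `X` lie in the same chart, and their coordinates differ from
those of `X` by at most a multiple of the distance. -/
theorem mul_edist_frameCoord_le_bundleEDist [T2Space N]
    (he : e ∈ IsManifold.maximalAtlas (𝓡 n) 2 N)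
    (hs : IsOpen s) (hG : IsMetricOn ν G s) (hG1 : IsOfClassOn MapClass.C1 G s) {Ω : Set N}
    {X Y : FrameBundle n N} (hX : X.base ∈ e.source)
    (hball : Metric.closedBall (frameCoord e X) r ⊆ frameDomain (e.target ∩ e.symm ⁻¹' s))
    (hspeed : ∀ z ∈ Metric.closedBall (frameCoord e X) r, ∀ u,
      c₀ * ‖u‖ ≤ coordSpeed (coordMetric e G) z u)
    (hc₀ : 0 < c₀) (hlen : bundleEDist G Ω X Y < ENNReal.ofReal (c₀ * r)) :
    Y.base ∈ e.source ∧
      ENNReal.ofReal c₀ * edist (frameCoord e Y) (frameCoord e X) ≤ bundleEDist G Ω X Y := by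
  -- Each piece starts with displacement at most the length used so far divided by `c₀`; with the
  -- length of the next piece this stays within the budget `c₀ * r`.
  have chain : ∀ (m : ℕ) (Z : ℕ → FrameBundle n N), Z 0 = X →
      ∑ i ∈ Finset.range m, c1EDist G Ω (Z i) (Z (i + 1)) < ENNReal.ofReal (c₀ * r) →
      (Z m).base ∈ e.source ∧ ENNReal.ofReal c₀ * edist (frameCoord e (Z m)) (frameCoord e X) ≤
        ∑ i ∈ Finset.range m, c1EDist G Ω (Z i) (Z (i + 1)) := by
    intro m Z hZ
    induction m with
    | zero =>
      intro _
      rw [hZ]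
      simp [hX]
    | succ m ih =>
      intro hm
      rw [Finset.sum_range_succ] at hm ⊢
      obtain ⟨i1, i2⟩ := ih (le_self_add.trans_lt hm)
      obtain ⟨j1, j2⟩ := mul_edist_frameCoord_le_c1EDist he hs hG hG1 hball hspeed hc₀ (Ω := Ω)
        (Y := Z (m + 1)) i1 (lt_of_le_of_lt (by gcongr) hm)
      refine ⟨j1, ?_⟩
      calc ENNReal.ofReal c₀ * edist (frameCoord e (Z (m + 1))) (frameCoord e X)
          ≤ ENNReal.ofReal c₀ * (edist (frameCoord e (Z (m + 1))) (frameCoord e (Z m)) +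
              edist (frameCoord e (Z m)) (frameCoord e X)) := by
            gcongr
            exact edist_triangle _ _ _
        _ ≤ _ := by
            rw [mul_add, add_comm]
            gcongr
  have key : ∀ L, bundleEDist G Ω X Y < L → L ≤ ENNReal.ofReal (c₀ * r) → Y.base ∈ e.source ∧
      ENNReal.ofReal c₀ * edist (frameCoord e Y) (frameCoord e X) ≤ L := by
    intro L hL hLr
    simp only [bundleEDist, iInf_lt_iff] at hL
    obtain ⟨m, Z, hZ0, hZm, hsum⟩ := hL
    obtain ⟨i1, i2⟩ := chain m Z hZ0 (hsum.trans_le hLr)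
    rw [hZm] at i1 i2
    exact ⟨i1, i2.trans hsum.le⟩
  refine ⟨(key _ hlen le_rfl).1, le_of_forall_gt_imp_ge_of_dense fun L hL => ?_⟩
  exact (key (min L _) (lt_min hL hlen) (min_le_right _ _)).2.trans (min_le_left _ _)

end LowerBound

/-! ### Segments in coordinates -/

section UpperBound

variable {n : ℕ} {M : Type*} [TopologicalSpace M] [ChartedSpace (Euc n) M]
  {e : OpenPartialHomeomorph M (Euc n)}

theorem frameCoord_injOn (he : e ∈ IsManifold.maximalAtlas (𝓡 n) 2 M) {X Y : FrameBundle n M}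
    (hX : X.base ∈ e.source) (hY : Y.base ∈ e.source) (h : frameCoord e X = frameCoord e Y) :
    X = Y := by
  obtain ⟨x, F⟩ := X
  obtain ⟨y, F'⟩ := Y
  have hxy : x = y := e.injOn hX hY (congrArg Prod.fst h)
  subst hxy
  congr 1
  refine Module.Basis.eq_of_apply_eq fun a => ?_
  exact (mdifferentiable_of_mem_maximalAtlas he).mfderiv_injective hX
    (congrFun (congrArg Prod.snd h) a)

theorem exists_frameCoord_eq (he : e ∈ IsManifold.maximalAtlas (𝓡 n) 2 M)
    {z : Euc n × (Fin n → Euc n)} (hz : z ∈ frameDomain e.target) :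
    ∃ X : FrameBundle n M, X.base ∈ e.source ∧ frameCoord e X = z := by
  have hsrc := e.map_target hz.1
  have hli : LinearIndependent ℝ z.2 := frameMatrix_det_ne_zero_iff.mp hz.2
  let b : Module.Basis (Fin n) ℝ (Euc n) := Module.Basis.mk hli
    (hli.span_eq_top_of_card_eq_finrank' (by simp)).ge
  let A := (mdifferentiable_of_mem_maximalAtlas he).mfderiv hsrc
  refine ⟨⟨e.symm z.1, b.map A.symm.toLinearEquiv⟩, hsrc, Prod.ext (e.right_inv hz.1) ?_⟩
  funext a
  have h1 : A (A.symm (b a)) = b a := A.apply_symm_apply _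
  have h2 : b a = z.2 a := Module.Basis.mk_apply _ _ a
  exact h1.trans h2

/-- The distance of two frames is at most a multiple of that of their coordinates, if the segment
between the coordinates stays in a set in which the speed is bounded. -/
theorem c1EDist_le_mul_edist_frameCoord [IsManifold (𝓡 n) 2 M]
    (he : e ∈ IsManifold.maximalAtlas (𝓡 n) 2 M) {ν : ℕ}
    {G : BilinField n M} (hG : IsMetricOn ν G univ) (hG1 : IsOfClassOn MapClass.C1 G univ)
    {X Y : FrameBundle n M} (hX : X.base ∈ e.source) (hY : Y.base ∈ e.source) {C : ℝ}
    (hseg : ∀ t ∈ Icc (0 : ℝ) 1,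
      AffineMap.lineMap (frameCoord e X) (frameCoord e Y) t ∈ frameDomain e.target)
    (hspeed : ∀ t ∈ Icc (0 : ℝ) 1, ∀ u, coordSpeed (coordMetric e G)
      (AffineMap.lineMap (frameCoord e X) (frameCoord e Y) t) u ≤ C * ‖u‖) (hC : 0 ≤ C) :
    c1EDist G univ X Y ≤ ENNReal.ofReal C * edist (frameCoord e X) (frameCoord e Y) := by
  classical
  set z : ℝ → Euc n × (Fin n → Euc n) := fun t =>
    AffineMap.lineMap (frameCoord e X) (frameCoord e Y) t with hz
  -- The segment is lifted pointwise by choice. This is harmless, since regularity is checked on the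
  -- coordinates and `frameCoord_injOn` identifies the endpoints.
  set c : ℝ → FrameBundle n M := fun t =>
    if h : z t ∈ frameDomain e.target then (exists_frameCoord_eq he h).choose else X with hc
  have hcz : ∀ t ∈ Icc (0 : ℝ) 1, (c t).base ∈ e.source ∧ frameCoord e (c t) = z t := by
    intro t ht
    have : c t = (exists_frameCoord_eq he (hseg t ht)).choose := dif_pos (hseg t ht)
    rw [this]
    exact (exists_frameCoord_eq he (hseg t ht)).choose_spec
  have h0 : (0 : ℝ) ∈ Icc (0 : ℝ) 1 := left_mem_Icc.mpr zero_le_one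
  have h1 : (1 : ℝ) ∈ Icc (0 : ℝ) 1 := right_mem_Icc.mpr zero_le_one
  have hc0 : c 0 = X := frameCoord_injOn he (hcz 0 h0).1 hX ((hcz 0 h0).2.trans (by simp [hz]))
  have hc1 : c 1 = Y := frameCoord_injOn he (hcz 1 h1).1 hY ((hcz 1 h1).2.trans (by simp [hz]))
  have hzd : ∀ t, HasDerivAt z (frameCoord e Y - frameCoord e X) t := fun t =>
    AffineMap.hasDerivAt_lineMap
  have hzc : ContDiff ℝ 1 z := by
    have : z = fun t => t • (frameCoord e Y - frameCoord e X) + frameCoord e X := by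
      funext t
      simp [hz, AffineMap.lineMap_apply]
    rw [this]
    fun_prop
  have hC1 : IsC1FrameCurve c := isC1FrameCurve_of_contDiffOn he (fun t ht => (hcz t ht).1)
    (hzc.contDiffOn.congr fun t ht => (hcz t ht).2)
  have hle : c1EDist G univ X Y ≤ ∫⁻ t in Icc (0 : ℝ) 1, ENNReal.ofReal (frameSpeed G c t) :=
    iInf_le_of_le c <| iInf_le_of_le hC1 <| iInf_le_of_le (fun _ _ => mem_univ _) <|
      iInf_le_of_le hc0 <| iInf_le_of_le hc1 le_rfl
  refine hle.trans ?_
  calc ∫⁻ t in Icc (0 : ℝ) 1, ENNReal.ofReal (frameSpeed G c t)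
      ≤ ∫⁻ _ in Icc (0 : ℝ) 1, ENNReal.ofReal (C * ‖frameCoord e Y - frameCoord e X‖) := by
        refine MeasureTheory.setLIntegral_mono' measurableSet_Icc fun t ht => ?_
        have hd : derivWithin (fun r => frameCoord e (c r)) (Icc 0 1) t =
            frameCoord e Y - frameCoord e X :=
          ((hzd t).hasDerivWithinAt.congr (fun r hr => (hcz r hr).2) (hcz t ht).2).derivWithin
            (uniqueDiffOn_Icc_zero_one t ht)
        rw [frameSpeed_eq_coordSpeed he isOpen_univ hG hG1 hC1 ht (hcz t ht).1 (mem_univ _), hd,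
          (hcz t ht).2]
        exact ENNReal.ofReal_le_ofReal (hspeed t ht _)
    _ = ENNReal.ofReal C * edist (frameCoord e X) (frameCoord e Y) := by
        rw [MeasureTheory.setLIntegral_const, Real.volume_Icc, sub_zero, ENNReal.ofReal_one,
          mul_one, ENNReal.ofReal_mul hC, ofReal_norm, ← edist_eq_enorm_sub, edist_comm]

end UpperBound

/-! ### Envelopments in charts -/

section Envelopment

variable {n : ℕ}
  {M : Type*} [TopologicalSpace M] [ChartedSpace (Euc n) M]
  {N : Type*} [TopologicalSpace N] [ChartedSpace (Euc n) N]
  {φ : M → N} {e : OpenPartialHomeomorph N (Euc n)}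

theorem IsEnvelopment.isOpenEmbedding (hφ : IsEnvelopment (n := n) φ) : IsOpenEmbedding φ :=
  ⟨hφ.isEmbedding, hφ.isLocalDiffeomorph.isOpen_range⟩

/-- The chart of `M` obtained from a chart of `N` by means of an envelopment. -/
def IsEnvelopment.pullbackChart [Nonempty M] (hφ : IsEnvelopment (n := n) φ)
    (e : OpenPartialHomeomorph N (Euc n)) : OpenPartialHomeomorph M (Euc n) :=
  (hφ.isOpenEmbedding.toOpenPartialHomeomorph φ).trans e

variable [Nonempty M] (hφ : IsEnvelopment (n := n) φ)

theorem IsEnvelopment.mem_pullbackChart_source {x : M} :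
    x ∈ (hφ.pullbackChart e).source ↔ φ x ∈ e.source := by
  simp [IsEnvelopment.pullbackChart]

theorem IsEnvelopment.pullbackChart_apply (x : M) : hφ.pullbackChart e x = e (φ x) := rfl

theorem IsEnvelopment.pullbackChart_target : (hφ.pullbackChart e).target = chartRegion φ e := by
  rw [← (hφ.pullbackChart e).image_source_eq_target]
  ext z
  constructor
  · rintro ⟨x, hx, rfl⟩
    exact ⟨φ x, ⟨hφ.mem_pullbackChart_source.mp hx, mem_range_self x⟩, rfl⟩
  · rintro ⟨_, ⟨hy, x, rfl⟩, rfl⟩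
    exact ⟨x, hφ.mem_pullbackChart_source.mpr hy, rfl⟩

/-- The inverse of the pulled-back chart agrees locally with a local `C²` inverse of `φ` composed
with `e.symm`. -/
theorem IsEnvelopment.pullbackChart_mem_maximalAtlas [IsManifold (𝓡 n) 2 M]
    (he : e ∈ IsManifold.maximalAtlas (𝓡 n) 2 N) :
    hφ.pullbackChart e ∈ IsManifold.maximalAtlas (𝓡 n) 2 M := by
  refine OpenPartialHomeomorph.mem_maximalAtlas_of_contMDiffOn (hφ.pullbackChart e) ?_ ?_
  · exact (contMDiffOn_of_mem_maximalAtlas he).comp hφ.isLocalDiffeomorph.contMDiff.contMDiffOn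
      fun x hx => hφ.mem_pullbackChart_source.mp hx
  · intro z hz
    obtain ⟨x, hx, rfl⟩ : ∃ x ∈ (hφ.pullbackChart e).source, hφ.pullbackChart e x = z :=
      ⟨_, (hφ.pullbackChart e).map_target hz, (hφ.pullbackChart e).right_inv hz⟩
    have hsrc := hφ.mem_pullbackChart_source.mp hx
    have hloc := hφ.isLocalDiffeomorph x
    have h1 : ContMDiffAt (𝓡 n) (𝓡 n) 2 (hloc.localInverse ∘ e.symm) (e (φ x)) := by
      refine ContMDiffAt.comp _ ?_ (contMDiffAt_symm_of_mem_maximalAtlas he (e.map_source hsrc))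
      rw [e.left_inv hsrc]
      exact hloc.localInverse_contMDiffAt
    refine ContMDiffAt.contMDiffWithinAt (h1.congr_of_eventuallyEq ?_)
    have hcont : ContinuousAt e.symm (e (φ x)) := e.continuousAt_symm (e.map_source hsrc)
    have hr : ∀ᶠ y in 𝓝 (e.symm (e (φ x))), φ (hloc.localInverse y) = y := by
      rw [e.left_inv hsrc]
      exact hloc.localInverse_eventuallyEq_right
    filter_upwards [hcont.eventually hr, (hφ.pullbackChart e).open_target.mem_nhds hz] with w hw hwt
    refine hφ.isOpenEmbedding.injective ?_
    have h2 : φ ((hφ.pullbackChart e).symm w) = e.symm w := by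
      have h3 := (hφ.pullbackChart e).map_target hwt
      have h4 := (hφ.pullbackChart e).right_inv hwt
      rw [hφ.pullbackChart_apply] at h4
      rw [← h4, e.left_inv (hφ.mem_pullbackChart_source.mp h3), h4]
    rw [h2, Function.comp_apply, hw]

theorem IsEnvelopment.mfderiv_pullbackChart (he : e ∈ IsManifold.maximalAtlas (𝓡 n) 2 N) {x : M}
    (hx : φ x ∈ e.source) (v : TangentSpace (𝓡 n) x) :
    (mfderiv (𝓡 n) (𝓡 n) (hφ.pullbackChart e) x v : Euc n) =
      mfderiv (𝓡 n) (𝓡 n) e (φ x) (mfderiv (𝓡 n) (𝓡 n) φ x v) := by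
  have h := mfderiv_comp x ((mdifferentiable_of_mem_maximalAtlas he).mdifferentiableAt hx)
    ((hφ.isLocalDiffeomorph x).mdifferentiableAt two_ne_zero)
  exact congrArg (fun A => (A v : Euc n)) h

theorem IsEnvelopment.frameCoord_pullbackChart [IsManifold (𝓡 n) 2 M] [IsManifold (𝓡 n) 2 N]
    (he : e ∈ IsManifold.maximalAtlas (𝓡 n) 2 N)
    (X : FrameBundle n M) (hX : φ X.base ∈ e.source) :
    frameCoord (hφ.pullbackChart e) X = frameCoord e (hφ.mapFrame X) :=
  Prod.ext rfl (funext fun a => hφ.mfderiv_pullbackChart he hX (X.frame a))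

/-- In the charts `hφ.pullbackChart e` and `e` the map `φ` is the identity, so bounds for the
extended metric pass to `g` unchanged. -/
theorem IsEnvelopment.coordMetric_pullbackChart [IsManifold (𝓡 n) 2 M]
    (he : e ∈ IsManifold.maximalAtlas (𝓡 n) 2 N)
    {g : BilinField n M} {G : BilinField n N}
    (hpull : ∀ (x : M) (v w : TangentSpace (𝓡 n) x),
      G (φ x) (mfderiv (𝓡 n) (𝓡 n) φ x v) (mfderiv (𝓡 n) (𝓡 n) φ x w) = g x v w)
    {z : Euc n} (hz : z ∈ (hφ.pullbackChart e).target) :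
    coordMetric (hφ.pullbackChart e) g z = coordMetric e G z := by
  obtain ⟨x, hx, rfl⟩ : ∃ x ∈ (hφ.pullbackChart e).source, hφ.pullbackChart e x = z :=
    ⟨_, (hφ.pullbackChart e).map_target hz, (hφ.pullbackChart e).right_inv hz⟩
  have hsrc := hφ.mem_pullbackChart_source.mp hx
  have hmax := hφ.pullbackChart_mem_maximalAtlas he
  have hform : ∀ v w : Euc n,
      bilinOfComponents n (coordMetric (hφ.pullbackChart e) g (hφ.pullbackChart e x)) v w =
        bilinOfComponents n (coordMetric e G (hφ.pullbackChart e x)) v w := by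
    intro v w
    have hs := (mdifferentiable_of_mem_maximalAtlas hmax).mfderiv_surjective hx
    obtain ⟨v, rfl⟩ := hs v
    obtain ⟨w, rfl⟩ := hs w
    refine (bilinField_apply_eq hmax g hx v w).symm.trans ((hpull x v w).symm.trans ?_)
    refine (bilinField_apply_eq he G hsrc _ _).trans ?_
    rw [hφ.mfderiv_pullbackChart he hsrc v, hφ.mfderiv_pullbackChart he hsrc w]
    rfl
  ext ab
  rw [← bilinOfComponents_single _ ab.1 ab.2, hform, bilinOfComponents_single]

end Envelopment

/-! ### Continuity of the coordinates of frames -/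

theorem FrameBundle.continuous_base_frame {n : ℕ} {N : Type*} [TopologicalSpace N]
    [ChartedSpace (Euc n) N] [IsManifold (𝓡 n) 1 N] :
    Continuous fun X : FrameBundle n N =>
      (X.base, fun a => (⟨X.base, X.frame a⟩ : TangentBundle (𝓡 n) N)) :=
  continuous_induced_dom

theorem FrameBundle.continuous_base {n : ℕ} {N : Type*} [TopologicalSpace N]
    [ChartedSpace (Euc n) N] [IsManifold (𝓡 n) 1 N] :
    Continuous (FrameBundle.base : FrameBundle n N → N) :=
  continuous_fst.comp FrameBundle.continuous_base_frame

/-- The topology of the frame bundle is induced from copies of the tangent bundle, where the tangent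
map of `e` is continuous. Hence compact sets of frames over the chart have compact coordinate
images. -/
theorem continuousOn_frameCoord {n : ℕ} {N : Type*} [TopologicalSpace N]
    [ChartedSpace (Euc n) N] [IsManifold (𝓡 n) 2 N]
    {e : OpenPartialHomeomorph N (Euc n)}
    (he : e ∈ IsManifold.maximalAtlas (𝓡 n) 2 N) :
    ContinuousOn (frameCoord e) {X : FrameBundle n N | X.base ∈ e.source} := by
  refine ContinuousOn.prodMk (e.continuousOn.comp FrameBundle.continuous_base.continuousOn
    fun X hX => hX) (continuousOn_pi.mpr fun a => ?_)
  have h1 : ContinuousOn (tangentMapWithin (𝓡 n) (𝓡 n) e e.source)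
      (Bundle.TotalSpace.proj ⁻¹' e.source) :=
    (contMDiffOn_of_mem_maximalAtlas he).continuousOn_tangentMapWithin one_le_two
      e.open_source.uniqueMDiffOn
  have h2 : Continuous fun X : FrameBundle n N =>
      (⟨X.base, X.frame a⟩ : TangentBundle (𝓡 n) N) :=
    (continuous_apply a).comp (continuous_snd.comp FrameBundle.continuous_base_frame)
  have h3 : Continuous fun Z : TangentBundle (𝓡 n) (Euc n) => (Z.2 : Euc n) :=
    continuous_snd.comp (tangentBundleModelSpaceHomeomorph (𝓡 n)).continuous
  refine ((h3.comp_continuousOn h1).comp h2.continuousOn fun X hX => hX).congr fun X hX => ?_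
  have h4 : mfderivWithin (𝓡 n) (𝓡 n) e e.source X.base = mfderiv (𝓡 n) (𝓡 n) e X.base :=
    mfderivWithin_of_isOpen e.open_source hX
  exact congrArg (fun A => (A (X.frame a) : Euc n)) h4.symm

/-! ### Domains below a Lipschitz graph -/

theorem norm_sub_inner_smul_le {n : ℕ} {k : Euc n} (hk : ‖k‖ = 1) (v : Euc n) :
    ‖v - ⟪k, v⟫_ℝ • k‖ ≤ ‖v‖ := by
  have h1 : ‖v - ⟪k, v⟫_ℝ • k‖ ^ 2 = ‖v‖ ^ 2 - ⟪k, v⟫_ℝ ^ 2 := by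
    rw [norm_sub_sq_real, inner_smul_right, real_inner_comm, norm_smul, hk, mul_one,
      Real.norm_eq_abs, sq_abs]
    ring
  refine (sq_le_sq₀ (norm_nonneg _) (norm_nonneg _)).mp ?_
  rw [h1]
  linarith [sq_nonneg ⟪k, v⟫_ℝ]

/-- Passing from `a` to `b` raises the height along `k` by at most `‖b - a‖` and lowers the graph by
at most `C * ‖b - a‖`. A descent by `σ` leaves the projection fixed and compensates for both. The
point `b` itself need not be in `V`. -/
theorem sub_smul_mem_of_lipschitz_graph {n : ℕ} {x₀ k : Euc n} {V : Set (Euc n)} {δ : ℝ}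
    {f : Euc n → ℝ} {C : NNReal} (hk : ‖k‖ = 1) (hf : LipschitzWith C f)
    (hV : ∀ y, ‖y - x₀‖ < δ →
      (y ∈ V ↔ ⟪k, y - x₀⟫_ℝ < f ((y - x₀) - ⟪k, y - x₀⟫_ℝ • k)))
    {a b : Euc n} {σ : ℝ} (ha : a ∈ V) (ha' : ‖a - x₀‖ < δ) (hb : ‖b - σ • k - x₀‖ < δ)
    (hσ : (C + 1) * ‖b - a‖ ≤ σ) : b - σ • k ∈ V := by
  have h1 := (hV a ha').mp ha
  rw [hV _ hb]
  have hi : ⟪k, b - σ • k - x₀⟫_ℝ = ⟪k, b - x₀⟫_ℝ - σ := by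
    rw [sub_right_comm, inner_sub_right, inner_smul_right, real_inner_self_eq_norm_sq, hk]
    ring
  have hp : (b - σ • k - x₀) - ⟪k, b - σ • k - x₀⟫_ℝ • k = (b - x₀) - ⟪k, b - x₀⟫_ℝ • k := by
    rw [hi, sub_smul]
    abel
  have hba : ⟪k, b - x₀⟫_ℝ = ⟪k, a - x₀⟫_ℝ + ⟪k, b - a⟫_ℝ := by
    rw [← inner_add_right]
    congr 1
    abel
  have hin : ⟪k, b - a⟫_ℝ ≤ ‖b - a‖ := by
    simpa [hk] using real_inner_le_norm k (b - a)
  have hdist : dist (f ((a - x₀) - ⟪k, a - x₀⟫_ℝ • k)) (f ((b - x₀) - ⟪k, b - x₀⟫_ℝ • k)) ≤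
      C * ‖b - a‖ := by
    refine (hf.dist_le_mul _ _).trans ?_
    gcongr
    rw [dist_comm, dist_eq_norm]
    refine le_of_eq_of_le ?_ (norm_sub_inner_smul_le hk (b - a))
    congr 1
    rw [hba, add_smul]
    abel
  have hle := (le_abs_self _).trans hdist
  rw [hp, hi]
  linarith

theorem bundleEDist_le_of_three {n : ℕ} {M : Type*} [TopologicalSpace M] [ChartedSpace (Euc n) M]
    (G : BilinField n M) (Ω : Set M) (X X₁ X₂ Y : FrameBundle n M) :
    bundleEDist G Ω X Y ≤ c1EDist G Ω X X₁ + c1EDist G Ω X₁ X₂ + c1EDist G Ω X₂ Y := by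
  let Z : ℕ → FrameBundle n M := fun i =>
    match i with
    | 0 => X
    | 1 => X₁
    | 2 => X₂
    | _ => Y
  unfold bundleEDist
  refine iInf_le_of_le 3 <| iInf_le_of_le Z <| iInf_le_of_le rfl <| iInf_le_of_le rfl
    (le_of_eq ?_)
  simp only [Finset.sum_range_succ, Finset.sum_range_zero, zero_add]
  rfl

/-! ### Comparison of the bundle metrics near a Lipschitz boundary point -/

section Comparison

variable {n : ℕ}
  {M : Type*} [TopologicalSpace M] [ChartedSpace (Euc n) M]
  {N : Type*} [TopologicalSpace N] [ChartedSpace (Euc n) N]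

/-- A neighbourhood of `e p` inside the closure of the region would pull back to one of `p` inside
the closure of `φ(M)`. -/
theorem mem_chartBoundary {L : MapClass} {ν : ℕ} {φ : M → N} {g : BilinField n M} {p : N}
    (hp : p ∈ frontier (range φ)) (hp' : p ∉ interior (closure (range φ)))
    (hext : IsExtendibleAbout L ν φ g p) {e : OpenPartialHomeomorph N (Euc n)}
    (hpe : p ∈ e.source) : e p ∈ chartBoundary L ν φ g e := by
  refine ⟨⟨p, ⟨hpe, hp⟩, rfl, hext⟩, fun h => hp' ?_⟩
  rw [mem_interior_iff_mem_nhds]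
  have h1 : ∀ᶠ y in 𝓝 p, e y ∈ closure (chartRegion φ e) := e.continuousAt hpe h.2
  filter_upwards [h1, e.open_source.mem_nhds hpe] with y hy hye
  have h2 : ContinuousAt e.symm (e y) := e.continuousAt_symm (e.map_source hye)
  have h3 := h2.continuousWithinAt.mem_closure_image hy
  rw [e.left_inv hye] at h3
  refine closure_mono ?_ h3
  rintro _ ⟨_, ⟨z, hz, rfl⟩, rfl⟩
  rw [e.left_inv hz.1]
  exact hz.2

variable [IsManifold (𝓡 n) 2 M] {ν : ℕ} {φ : M → N}
  {e : OpenPartialHomeomorph N (Euc n)} {g : BilinField n M} {G : BilinField n N}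

theorem IsEnvelopment.c1EDist_le_of_segment [Nonempty M] (hφ : IsEnvelopment (n := n) φ)
    (he : e ∈ IsManifold.maximalAtlas (𝓡 n) 2 N)
    (hg : IsMetricOn ν g univ) (hg1 : IsOfClassOn MapClass.C1 g univ)
    (hpull : ∀ (x : M) (v w : TangentSpace (𝓡 n) x),
      G (φ x) (mfderiv (𝓡 n) (𝓡 n) φ x v) (mfderiv (𝓡 n) (𝓡 n) φ x w) = g x v w)
    {X Y : FrameBundle n M} (hX : φ X.base ∈ e.source) (hY : φ Y.base ∈ e.source) {C : ℝ}
    (hC : 0 ≤ C) {S : Set (Euc n × (Fin n → Euc n))}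
    (hS : ∀ z ∈ S, (frameMatrix z.2).det ≠ 0)
    (hspeed : ∀ z ∈ S, ∀ u, coordSpeed (coordMetric e G) z u ≤ C * ‖u‖)
    {zX zY : Euc n × (Fin n → Euc n)} (hzX : frameCoord (hφ.pullbackChart e) X = zX)
    (hzY : frameCoord (hφ.pullbackChart e) Y = zY)
    (hseg : ∀ t ∈ Icc (0 : ℝ) 1, AffineMap.lineMap zX zY t ∈ S)
    (hreg : ∀ t ∈ Icc (0 : ℝ) 1, AffineMap.lineMap zX.1 zY.1 t ∈ chartRegion φ e) :
    c1EDist g univ X Y ≤ ENNReal.ofReal C * edist zX zY := by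
  subst hzX hzY
  have hfst : ∀ (z z' : Euc n × (Fin n → Euc n)) (t : ℝ),
      (AffineMap.lineMap z z' t : Euc n × (Fin n → Euc n)).1 = AffineMap.lineMap z.1 z'.1 t := by
    intro z z' t
    simp [AffineMap.lineMap_apply]
  refine c1EDist_le_mul_edist_frameCoord (hφ.pullbackChart_mem_maximalAtlas he) hg hg1
    (hφ.mem_pullbackChart_source.mpr hX) (hφ.mem_pullbackChart_source.mpr hY)
    (fun t ht => ⟨?_, hS _ (hseg t ht)⟩) (fun t ht u => ?_) hC
  · rw [hfst, hφ.pullbackChart_target]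
    exact hreg t ht
  · refine le_of_eq_of_le (coordSpeed_congr ?_ u) (hspeed _ (hseg t ht) u)
    have hmem := hreg t ht
    rw [← hφ.pullbackChart_target] at hmem
    rw [hfst]
    filter_upwards [(hφ.pullbackChart e).open_target.mem_nhds hmem] with z hz
    exact hφ.coordMetric_pullbackChart he hpull hz

end Comparison

section Comparison

variable {n : ℕ}
  {M : Type*} [TopologicalSpace M] [ChartedSpace (Euc n) M]
  {N : Type*} [TopologicalSpace N] [ChartedSpace (Euc n) N]
  [IsManifold (𝓡 n) 2 M] {ν : ℕ} {φ : M → N}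
  {e : OpenPartialHomeomorph N (Euc n)} {g : BilinField n M} {G : BilinField n N}

/-- Below a Lipschitz graph, the bundle distance of two frames is at most a multiple of the distance
of their coordinates. -/
theorem IsEnvelopment.bundleEDist_le_of_lipschitz_graph [Nonempty M]
    (hφ : IsEnvelopment (n := n) φ) (he : e ∈ IsManifold.maximalAtlas (𝓡 n) 2 N)
    (hg : IsMetricOn ν g univ) (hg1 : IsOfClassOn MapClass.C1 g univ)
    (hpull : ∀ (x : M) (v w : TangentSpace (𝓡 n) x),
      G (φ x) (mfderiv (𝓡 n) (𝓡 n) φ x v) (mfderiv (𝓡 n) (𝓡 n) φ x w) = g x v w)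
    {x₀ k : Euc n} {δ : ℝ} {f : Euc n → ℝ} {Cf : NNReal} (hk : ‖k‖ = 1) (hf : LipschitzWith Cf f)
    (hV : ∀ y, ‖y - x₀‖ < δ → (y ∈ chartRegion φ e ↔
      ⟪k, y - x₀⟫_ℝ < f ((y - x₀) - ⟪k, y - x₀⟫_ℝ • k)))
    {X Y : FrameBundle n M} (hX : φ X.base ∈ e.source) (hY : φ Y.base ∈ e.source) {C r : ℝ}
    (hC : 0 ≤ C)
    (hdet : ∀ z ∈ Metric.closedBall (frameCoord (hφ.pullbackChart e) X) r,
      (frameMatrix z.2).det ≠ 0)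
    (hspeed : ∀ z ∈ Metric.closedBall (frameCoord (hφ.pullbackChart e) X) r, ∀ u,
      coordSpeed (coordMetric e G) z u ≤ C * ‖u‖)
    (hrδ : dist (e (φ X.base)) x₀ + r < δ)
    (hr : (Cf + 2) * dist (frameCoord (hφ.pullbackChart e) X) (frameCoord (hφ.pullbackChart e) Y) ≤
      r) :
    bundleEDist g univ X Y ≤ ENNReal.ofReal (C * (2 * Cf + 3) *
      dist (frameCoord (hφ.pullbackChart e) X) (frameCoord (hφ.pullbackChart e) Y)) := by
  set zX := frameCoord (hφ.pullbackChart e) X with hzX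
  set zY := frameCoord (hφ.pullbackChart e) Y with hzY
  set D := dist zX zY with hD
  have hD0 : 0 ≤ D := dist_nonneg
  have hCf : (0 : ℝ) ≤ Cf := Cf.2
  set a := zX.1 with ha
  set b := zY.1 with hb
  have hab : ‖b - a‖ ≤ D := by
    rw [← dist_eq_norm, dist_comm]
    exact le_max_left _ _
  -- The least descent allowed by `sub_smul_mem_of_lipschitz_graph` for every point of the segment
  -- from `a` to `b`.
  set σ := (Cf + 1) * ‖b - a‖ with hσ
  have hσ0 : 0 ≤ σ := by positivity
  have hσD : σ ≤ (Cf + 1) * D := by rw [hσ]; gcongr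
  have haV : a ∈ chartRegion φ e := ⟨φ X.base, ⟨hX, mem_range_self _⟩, rfl⟩
  have hbV : b ∈ chartRegion φ e := ⟨φ Y.base, ⟨hY, mem_range_self _⟩, rfl⟩
  set z₁ : Euc n × (Fin n → Euc n) := (a - σ • k, zX.2) with hz₁
  set z₂ : Euc n × (Fin n → Euc n) := (b - σ • k, zY.2) with hz₂
  have hd1 : dist zX z₁ = σ := by
    rw [Prod.dist_eq, hz₁, dist_self, max_eq_left dist_nonneg, dist_eq_norm, sub_sub_cancel,
      norm_smul, hk, mul_one, Real.norm_of_nonneg hσ0]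
  have hd3 : dist z₂ zY = σ := by
    rw [dist_comm, Prod.dist_eq, hz₂, dist_self, max_eq_left dist_nonneg, dist_eq_norm,
      sub_sub_cancel, norm_smul, hk, mul_one, Real.norm_of_nonneg hσ0]
  have hd2 : dist z₁ z₂ = D := by
    rw [Prod.dist_eq, hz₁, hz₂, dist_sub_right, hD, Prod.dist_eq]
  have hmX : zX ∈ Metric.closedBall zX r := Metric.mem_closedBall_self (by nlinarith)
  have hm1 : z₁ ∈ Metric.closedBall zX r := by
    rw [Metric.mem_closedBall, dist_comm, hd1]
    nlinarith
  -- The farthest corner: its distance is at most `σ + D ≤ (Cf + 2) * D`, which is why `hr` has this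
  -- factor.
  have hm2 : z₂ ∈ Metric.closedBall zX r := by
    rw [Metric.mem_closedBall]
    have := dist_triangle z₂ z₁ zX
    rw [dist_comm z₂ z₁, dist_comm z₁ zX, hd1, hd2] at this
    nlinarith
  have hmY : zY ∈ Metric.closedBall zX r := by
    rw [Metric.mem_closedBall, dist_comm]
    nlinarith
  have hseg : ∀ {z z' : Euc n × (Fin n → Euc n)}, z ∈ Metric.closedBall zX r →
      z' ∈ Metric.closedBall zX r → ∀ t ∈ Icc (0 : ℝ) 1,
      AffineMap.lineMap z z' t ∈ Metric.closedBall zX r := fun {z z'} hz hz' t ht =>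
    (convex_closedBall zX r).lineMap_mem hz hz' ht
  have hball : ∀ z ∈ Metric.closedBall zX r, ‖z.1 - x₀‖ < δ := by
    intro z hz
    rw [← dist_eq_norm]
    have h1 : dist z.1 zX.1 ≤ r := (le_max_left _ _).trans hz
    have h2 : dist zX.1 x₀ = dist (e (φ X.base)) x₀ := rfl
    linarith [dist_triangle z.1 zX.1 x₀]
  have hballseg : ∀ {z z' : Euc n × (Fin n → Euc n)}, z ∈ Metric.closedBall zX r →
      z' ∈ Metric.closedBall zX r → ∀ t ∈ Icc (0 : ℝ) 1,
      ‖AffineMap.lineMap z.1 z'.1 t - x₀‖ < δ := by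
    intro z z' hz hz' t ht
    have := hball _ (hseg hz hz' t ht)
    simpa [AffineMap.lineMap_apply] using this
  have hreg1 : ∀ t ∈ Icc (0 : ℝ) 1, AffineMap.lineMap zX.1 z₁.1 t ∈ chartRegion φ e := by
    intro t ht
    have h1 := hballseg hmX hm1 t ht
    have h2 : (AffineMap.lineMap zX.1 z₁.1 t : Euc n) = a - (t * σ) • k := by
      simp only [AffineMap.lineMap_apply, hz₁, vsub_eq_sub, vadd_eq_add, ← ha]
      module
    rw [h2] at h1 ⊢
    refine sub_smul_mem_of_lipschitz_graph hk hf hV haV (hball zX hmX) h1 ?_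
    simpa using mul_nonneg ht.1 hσ0
  have hreg2 : ∀ t ∈ Icc (0 : ℝ) 1, AffineMap.lineMap z₁.1 z₂.1 t ∈ chartRegion φ e := by
    intro t ht
    have h1 := hballseg hm1 hm2 t ht
    have h2 : (AffineMap.lineMap z₁.1 z₂.1 t : Euc n) = (a + t • (b - a)) - σ • k := by
      simp only [AffineMap.lineMap_apply, hz₁, hz₂, vsub_eq_sub, vadd_eq_add]
      module
    rw [h2] at h1 ⊢
    refine sub_smul_mem_of_lipschitz_graph hk hf hV haV (hball zX hmX) h1 ?_
    rw [add_sub_cancel_left, norm_smul, Real.norm_of_nonneg ht.1]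
    exact mul_le_mul_of_nonneg_left (mul_le_of_le_one_left (norm_nonneg _) ht.2) (by positivity)
  have hreg3 : ∀ t ∈ Icc (0 : ℝ) 1, AffineMap.lineMap z₂.1 zY.1 t ∈ chartRegion φ e := by
    intro t ht
    have h1 := hballseg hm2 hmY t ht
    have h2 : (AffineMap.lineMap z₂.1 zY.1 t : Euc n) = b - ((1 - t) * σ) • k := by
      simp only [AffineMap.lineMap_apply, hz₂, vsub_eq_sub, vadd_eq_add, ← hb]
      module
    rw [h2] at h1 ⊢
    refine sub_smul_mem_of_lipschitz_graph hk hf hV hbV (hball zY hmY) h1 ?_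
    simpa using mul_nonneg (sub_nonneg.mpr ht.2) hσ0
  have hmax := hφ.pullbackChart_mem_maximalAtlas he
  have h0 : (0 : ℝ) ∈ Icc (0 : ℝ) 1 := left_mem_Icc.mpr zero_le_one
  have hz₁V : z₁.1 ∈ (hφ.pullbackChart e).target := by
    rw [hφ.pullbackChart_target]
    simpa using hreg2 0 h0
  have hz₂V : z₂.1 ∈ (hφ.pullbackChart e).target := by
    rw [hφ.pullbackChart_target]
    simpa using hreg3 0 h0
  obtain ⟨X₁, hX₁, hX₁z⟩ := exists_frameCoord_eq hmax ⟨hz₁V, hdet z₁ hm1⟩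
  obtain ⟨X₂, hX₂, hX₂z⟩ := exists_frameCoord_eq hmax ⟨hz₂V, hdet z₂ hm2⟩
  rw [hφ.mem_pullbackChart_source] at hX₁ hX₂
  have l1 := hφ.c1EDist_le_of_segment he hg hg1 hpull hX hX₁ hC hdet hspeed rfl hX₁z
    (hseg hmX hm1) hreg1
  have l2 := hφ.c1EDist_le_of_segment he hg hg1 hpull hX₁ hX₂ hC hdet hspeed hX₁z hX₂z
    (hseg hm1 hm2) hreg2
  have l3 := hφ.c1EDist_le_of_segment he hg hg1 hpull hX₂ hY hC hdet hspeed hX₂z rfl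
    (hseg hm2 hmY) hreg3
  rw [edist_dist, ← ENNReal.ofReal_mul hC] at l1 l2 l3
  rw [← hzX, hd1] at l1
  rw [hd2] at l2
  rw [← hzY, hd3] at l3
  refine (bundleEDist_le_of_three g univ X X₁ X₂ Y).trans ((add_le_add (add_le_add l1 l2) l3).trans
    ?_)
  rw [← ENNReal.ofReal_add (by positivity) (by positivity),
    ← ENNReal.ofReal_add (by positivity) (by positivity)]
  refine ENNReal.ofReal_le_ofReal ?_
  -- The path has coordinate length `2 * σ + D ≤ (2 * Cf + 3) * D`.
  nlinarith [mul_le_mul_of_nonneg_left hσD hC]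

end Comparison

/-- Both bounds are applied in one chart and the coordinate distance is eliminated. `U` comes from
the chart alone, before `K`; the constants `η` and `Λ` depend on `K`. -/
theorem exists_bundleEDist_le_mul {n ν : ℕ}
    {M : Type*} [TopologicalSpace M] [ChartedSpace (Euc n) M] [IsManifold (𝓡 n) 2 M]
    {N : Type*} [TopologicalSpace N] [ChartedSpace (Euc n) N] [IsManifold (𝓡 n) 2 N] [T2Space N]
    {L : MapClass} (hL : L.SubsetC1)
    {g : BilinField n M} (hg : IsMetricOn ν g univ) (hg1 : IsOfClassOn MapClass.C1 g univ)
    {φ : M → N} (hφ : IsEnvelopment (n := n) φ) (hLip : HasLipschitzBoundary L ν φ g)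
    {p : N} (hp : p ∈ frontier (range φ)) (hp' : p ∉ interior (closure (range φ)))
    {Up : Set N} {gp : BilinField n N} (hext : IsExtensionAbout L ν φ g p Up gp) :
    ∃ U ∈ 𝓝 p, ∀ K : Set (FrameBundle n N), IsCompact K →
      ∃ η > 0, ∃ Λ : ℝ≥0∞, Λ ≠ ⊤ ∧ ∀ X Y : FrameBundle n M, φ X.base ∈ U → φ Y.base ∈ U →
        hφ.mapFrame X ∈ K →
        bundleEDist gp (range φ ∪ Up) (hφ.mapFrame X) (hφ.mapFrame Y) < η →
        bundleEDist g univ X Y ≤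
          Λ * bundleEDist gp (range φ ∪ Up) (hφ.mapFrame X) (hφ.mapFrame Y) := by
  obtain ⟨A, hA, hcover, hchart, -⟩ := hLip
  obtain ⟨e, heA, hpe⟩ := hcover p
  have he := hA heA
  obtain ⟨-, k, -, hk⟩ := hchart e heA
  obtain ⟨hk1, δ, hδ, f, ⟨Cf, hf⟩, hV⟩ := hk (e p) (mem_chartBoundary hp hp' ⟨Up, gp, hext⟩ hpe)
  have hne : Nonempty M := by
    have := closure_nonempty_iff.mp ⟨p, hp.1⟩
    exact range_nonempty_iff_nonempty.mp this
  have hG : IsMetricOn ν gp Up := fun y hy => hext.isMetricOn y (Or.inr hy)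
  have hG1 : IsOfClassOn MapClass.C1 gp Up := fun e' he' =>
    hL _ _ _ _ (e'.isOpen_inter_preimage_symm hext.isOpen) (hext.isOfClassOn e' he')
  set W := e.target ∩ e.symm ⁻¹' Up with hW
  have hWo : IsOpen W := e.isOpen_inter_preimage_symm hext.isOpen
  have hpW : e p ∈ W := ⟨e.map_source hpe, by simpa [e.left_inv hpe] using hext.mem⟩
  -- Half of `δ` is kept in reserve for the radius `r ≤ δ / 2`, so that the balls about frames over
  -- `U` stay where the graph describes the region.
  obtain ⟨R, hR, hRW⟩ := Metric.nhds_basis_closedBall.mem_iff.mp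
    (inter_mem (hWo.mem_nhds hpW) (Metric.ball_mem_nhds (e p) (half_pos hδ)))
  refine ⟨e.source ∩ e ⁻¹' Metric.closedBall (e p) R, inter_mem (e.open_source.mem_nhds hpe)
    (e.continuousAt hpe (Metric.closedBall_mem_nhds _ hR)), fun K hK => ?_⟩
  have hcB : IsCompact (e.symm '' Metric.closedBall (e p) R) :=
    (isCompact_closedBall _ _).image_of_continuousOn
      (e.continuousOn_symm.mono fun x hx => (hRW hx).1.1)
  set K' := K ∩ FrameBundle.base ⁻¹' (e.symm '' Metric.closedBall (e p) R) with hK'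
  have hK'c : IsCompact K' :=
    hK.inter_right (hcB.isClosed.preimage FrameBundle.continuous_base)
  have hK's : ∀ Z ∈ K', Z.base ∈ e.source ∧ e Z.base ∈ Metric.closedBall (e p) R := by
    rintro Z ⟨-, x, hx, hxZ⟩
    rw [← hxZ, e.right_inv (hRW hx).1.1]
    exact ⟨e.map_target (hRW hx).1.1, hx⟩
  have hKc : IsCompact (frameCoord e '' K') :=
    hK'c.image_of_continuousOn ((continuousOn_frameCoord he).mono fun Z hZ => (hK's Z hZ).1)
  have hKW : frameCoord e '' K' ⊆ frameDomain W := by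
    rintro _ ⟨Z, hZ, rfl⟩
    exact ⟨(hRW (hK's Z hZ).2).1, frameMatrix_frameCoord_det_ne_zero he Z (hK's Z hZ).1⟩
  -- A compact thickening gives a common radius and common speed bounds for all starting frames in
  -- `K'`.
  obtain ⟨r₀, hr₀, hr₀W⟩ := hKc.exists_cthickening_subset_open (isOpen_frameDomain hWo) hKW
  obtain ⟨c₀, hc₀, C, hC, hbound⟩ := exists_coordSpeed_bounds hWo
    (contDiffOn_coordMetric he hext.isOpen hG1)
    (fun x hx => isScalarProduct_coordMetric he hG hx.1 hx.2)
    (hKc.cthickening (r := r₀)) hr₀W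
  set r := min r₀ (δ / 2) with hr
  have hr0 : 0 < r := lt_min hr₀ (half_pos hδ)
  have hCf : (0 : ℝ) ≤ Cf := Cf.2
  -- This `η` is at most `c₀ * r`, as the lower bound requires, and it forces `D < r / (Cf + 2)`, as
  -- the three-segment path requires. `Λ` is the upper constant divided by `c₀`.
  refine ⟨ENNReal.ofReal (c₀ * (r / (Cf + 2))), ENNReal.ofReal_pos.mpr (by positivity),
    ENNReal.ofReal (C * (2 * Cf + 3)) * (ENNReal.ofReal c₀)⁻¹,
    ENNReal.mul_ne_top ENNReal.ofReal_ne_top (ENNReal.inv_ne_top.mpr (by simpa using hc₀)),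
    fun X Y hXU hYU hXK hlt => ?_⟩
  have hXK' : hφ.mapFrame X ∈ K' := ⟨hXK, e (φ X.base), hXU.2, e.left_inv hXU.1⟩
  have hsub : Metric.closedBall (frameCoord e (hφ.mapFrame X)) r ⊆
      Metric.cthickening r₀ (frameCoord e '' K') :=
    (Metric.closedBall_subset_closedBall (min_le_left _ _)).trans
      (Metric.closedBall_subset_cthickening (mem_image_of_mem _ hXK') r₀)
  obtain ⟨-, hlow⟩ := mul_edist_frameCoord_le_bundleEDist he hext.isOpen hG hG1
    (Ω := range φ ∪ Up) (X := hφ.mapFrame X) (Y := hφ.mapFrame Y) (r := r) (c₀ := c₀) hXU.1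
    (hsub.trans hr₀W) (fun z hz u => (hbound z (hsub hz) u).1) hc₀ (by
      refine hlt.trans_le (ENNReal.ofReal_le_ofReal ?_)
      gcongr
      exact div_le_self hr0.le (by linarith))
  have hXc := hφ.frameCoord_pullbackChart he X hXU.1
  have hYc := hφ.frameCoord_pullbackChart he Y hYU.1
  rw [← hXc, ← hYc, edist_comm] at hlow
  rw [← hXc] at hsub
  set D := dist (frameCoord (hφ.pullbackChart e) X) (frameCoord (hφ.pullbackChart e) Y) with hD
  rw [edist_dist, ← hD] at hlow
  have hDr : D < r / (Cf + 2) := by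
    have := hlow.trans_lt hlt
    rw [← ENNReal.ofReal_mul hc₀.le, ENNReal.ofReal_lt_ofReal_iff (by positivity)] at this
    exact lt_of_mul_lt_mul_left this hc₀.le
  have hup := hφ.bundleEDist_le_of_lipschitz_graph he hg hg1 hext.pullback hk1 hf hV hXU.1 hYU.1
    (r := r) hC.le (fun z hz => (hr₀W (hsub hz)).2) (fun z hz u => (hbound z (hsub hz) u).2)
    (by
      have h1 : dist (e (φ X.base)) (e p) < δ / 2 := (hRW hXU.2).2
      linarith [min_le_right r₀ (δ / 2)])
    (by
      rw [lt_div_iff₀ (by positivity)] at hDr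
      linarith)
  refine hup.trans ?_
  rw [← hD, ENNReal.ofReal_mul (by positivity), mul_assoc]
  gcongr
  rw [← ENNReal.div_eq_inv_mul, ENNReal.le_div_iff_mul_le (Or.inl (by simpa using hc₀))
    (Or.inl ENNReal.ofReal_ne_top), mul_comm]
  exact hlow

end

theorem mainTheorem3 {n ν : ℕ}
    {M : Type*} [TopologicalSpace M] [ChartedSpace (Euc n) M] [IsManifold (𝓡 n) 2 M]
    [T2Space M] [ParacompactSpace M]
    {N : Type*} [TopologicalSpace N] [ChartedSpace (Euc n) N] [IsManifold (𝓡 n) 2 N]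
    [T2Space N] [ParacompactSpace N]
    (L : MapClass) (hL : L.SubsetC1)
    (g : BilinField n M) (hg : IsMetricOn ν g univ) (hg1 : IsOfClassOn MapClass.C1 g univ)
    (φ : M → N) (hφ : IsEnvelopment (n := n) φ)
    (hE : ∀ q ∈ frontier (range φ), IsExtendibleAbout L ν φ g q)
    (hLip : HasLipschitzBoundary L ν φ g)
    (p : N) (hp : p ∈ frontier (range φ)) (hp' : p ∉ interior (closure (range φ)))
    (Up : Set N) (gp : BilinField n N) (hext : IsExtensionAbout L ν φ g p Up gp) :
    ∃ U ∈ 𝓝 p, ∀ K : Set (FrameBundle n N), IsCompact K →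
      ¬ ∃ x y : ℕ → FrameBundle n M,
        (∀ i, φ (x i).base ∈ U ∧ φ (y i).base ∈ U) ∧
        (∀ i, hφ.mapFrame (x i) ∈ K) ∧
        Tendsto
          (fun i => bundleEDist gp (range φ ∪ Up) (hφ.mapFrame (x i)) (hφ.mapFrame (y i)))
          atTop (𝓝 0) ∧
        ∃ ε : ℝ≥0∞, 0 < ε ∧ ∀ i, ε ≤ bundleEDist g univ (x i) (y i) := by
  obtain ⟨U, hU, hUK⟩ := exists_bundleEDist_le_mul hL hg hg1 hφ hLip hp hp' hext
  refine ⟨U, hU, fun K hK => ?_⟩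
  rintro ⟨x, y, hxy, hxK, hlim, ε, hε, hεle⟩
  obtain ⟨η, hη, Λ, hΛ, hle⟩ := hUK K hK
  -- Since `Λ` is finite, `Λ` times the extended distance also tends to zero and drops below `ε`.
  have hlim' := ENNReal.Tendsto.const_mul hlim (Or.inr hΛ)
  rw [mul_zero] at hlim'
  obtain ⟨i, hi, hi'⟩ := ((hlim.eventually_lt_const hη).and
    (hlim'.eventually_lt_const hε)).exists
  exact absurd ((hle (x i) (y i) (hxy i).1 (hxy i).2 (hxK i) hi).trans_lt hi')
    (not_lt.mpr (hεle i))
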